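/- Let $R$ be a commutative unital ring and let $\mathrm{Aff}_R=(\mathrm{cAlg}_R)^{\mathrm{op}}$ be the category of affine schemes over $R$, the opposite of the category of commutative unital $R$-algebras; its binary products are given by the tensor product $\otimes_R$ of algebras. A tangent structure $\mathbb T=(T,p,z,s,l,c)$ on a category $\mathbb X$ consists of an endofunctor $T$ (the tangent bundle functor) and natural transformations $p_M:TM\to M$, $z_M:M\to TM$, $s_M:T_2M\to TM$, $l_M:TM\to T^2M$, $c_M:T^2M\to T^2M$, where for every $n$ the $n$-fold pullback $T_nM$ of $p_M$ along itself is required to exist and to be preserved by all iterates $T^k$, with projections $\pi_i:T_nM\to TM$, such that: (1) $(p_M,z_M,s_M)$ is an additive bundle, i.e. $z_M$ and $s_M$ make $p_M$ a commutative monoid in the slice category $\mathbb X/M$; (2) $(z_M,l_M)$ is an additive bundle morphism $(p_M,z_M,s_M)\to(Tp_M,Tz_M,Ts_M)$, i.e. $Tp_M\circ l_M=z_M\circ p_M$, $l_M\circ z_M=Tz_M\circ z_M$ and $Ts_M\circ\langle l_M\pi_1,l_M\pi_2\rangle=l_M\circ s_M$; (3) $(\mathrm{id}_{TM},c_M)$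 is an additive bundle morphism $(p_{TM},z_{TM},s_{TM})\to(Tp_M,Tz_M,Ts_M)$, in the same sense; (4) $Tl_M\circ l_M=l_{TM}\circ l_M$, $c_M\circ c_M=\mathrm{id}$, and $Tc_M\circ c_{TM}\circ Tc_M=c_{TM}\circ Tc_M\circ c_{TM}$; (5) $c_M\circ l_M=l_M$ and $c_{TM}\circ Tc_M\circ l_{TM}=Tl_M\circ c_M$; (6) the square formed by $Ts_M\circ\langle l_M\pi_1,z_{TM}\pi_2\rangle:T_2M\to T^2M$, $p_M\pi_1:T_2M\to M$, $Tp_M:T^2M\to TM$ and $z_M:M\to TM$ is a pullback. If $\mathbb X$ has finite products, $\mathbb T$ is called representable if for every positive integer $n$ there is an object $D_n$ of $\mathbb X$ such that the functor $T_n:\mathbb X\to\mathbb X$ is right adjoint to $D_n\times-:\mathbb X\to\mathbb X$. A commutative solid non-unital $R$-algebra is an $R$-module $M$ with an associative commutative multiplication $\alpha:M\otimes_RM\to M$ (no unit is required) which is an isomorphism of $R$-modules; it is called finitely generated projective if its underlying $R$-module is. For an $R$-module $M$, $R\ltimes M$ denotes the square-zero extension, the commutative $R$-algebra $R\oplus M$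 with $(a+m)(b+n)=ab+an+bm$. **Corollary.** A tangent structure $\mathbb T$ on $\mathrm{Aff}_R$ is representable if and only if there is a finitely generated projective commutative solid non-unital $R$-algebra $M$ such that the tangent bundle functor $T:\mathrm{Aff}_R\to\mathrm{Aff}_R$ is right adjoint to the functor $D\otimes_R-:\mathrm{Aff}_R\to\mathrm{Aff}_R$, where $D=R\ltimes M$. -/

import Mathlib

open CategoryTheory CategoryTheory.Limits Opposite MonoidalCategory

universe u

noncomputable section

namespace TangentCat

universe v v₁ u₁

section FoldPullback

variable {C : Type u} [Category.{v} C] {D : Type u₁} [Category.{v₁} D]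

/-- The cospan consisting of `n` copies of `q : E ⟶ B`. -/
abbrev foldCospan {E B : C} (q : E ⟶ B) (n : ℕ) : WidePullbackShape (Fin n) ⥤ C :=
  WidePullbackShape.wideCospan B (fun _ : Fin n => E) (fun _ => q)

/-- The `n`-fold pullback of `q : E ⟶ B` along itself exists. -/
abbrev HasFoldPullback {E B : C} (q : E ⟶ B) (n : ℕ) : Prop :=
  HasWidePullback B (fun _ : Fin n => E) (fun _ => q)

/-- The `n`-fold pullback `Eₙ = E ×_B ⋯ ×_B E` of `q : E ⟶ B` along itself. -/
abbrev foldPullback {E B : C} (q : E ⟶ B) (n : ℕ) [HasFoldPullback q n] : C :=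
  widePullback B (fun _ : Fin n => E) (fun _ => q)

/-- The `i`-th projection `Eₙ ⟶ E`. -/
abbrev foldπ {E B : C} (q : E ⟶ B) {n : ℕ} [HasFoldPullback q n] (i : Fin n) :
    foldPullback q n ⟶ E :=
  WidePullback.π (fun _ : Fin n => q) i

theorem foldπ_comp {E B : C} (q : E ⟶ B) {n : ℕ} [HasFoldPullback q n] (i j : Fin n) :
    foldπ q i ≫ q = foldπ q j ≫ q :=
  (WidePullback.π_arrow (fun _ : Fin n => q) i).trans
    (WidePullback.π_arrow (fun _ : Fin n => q) j).symm

/-- The induced morphism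
`f ×_g ⋯ ×_g f : Eₙ ⟶ E'ₙ` for a commutative square `(f, g)` from `q` to `q'`. -/
def foldMap {E B E' B' : C} {q : E ⟶ B} {q' : E' ⟶ B'} (f : E ⟶ E') (g : B ⟶ B')
    (h : f ≫ q' = q ≫ g) (n : ℕ) [HasFoldPullback q n] [HasFoldPullback q' n] :
    foldPullback q n ⟶ foldPullback q' n :=
  WidePullback.lift (WidePullback.base (fun _ : Fin n => q) ≫ g) (fun i => foldπ q i ≫ f)
    (fun i => by
      rw [Category.assoc, h, ← Category.assoc, WidePullback.π_arrow (fun _ : Fin n => q) i])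

/-- The pairing `⟨f, g⟩ : X ⟶ E₂`. -/
def foldPair {E B : C} (q : E ⟶ B) [HasFoldPullback q 2] {X : C} (f g : X ⟶ E)
    (h : f ≫ q = g ≫ q) : X ⟶ foldPullback q 2 :=
  WidePullback.lift (f ≫ q) ![f, g] (by
    intro i
    fin_cases i
    · rfl
    · exact h.symm)

/-- The pairing `⟨f, g⟩ : X ⟶ F(E₂)`, when `F` preserves the pullback `E₂`, that is, when
`F(E₂)` is the pullback of `F(q)` along itself. -/
def mapPair (F : C ⥤ D) {E B : C} (q : E ⟶ B) [HasFoldPullback q 2]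
    [PreservesLimit (foldCospan q 2) F] {X : D} (f g : X ⟶ F.obj E)
    (h : f ≫ F.map q = g ≫ F.map q) : X ⟶ F.obj (foldPullback q 2) :=
  (isLimitOfPreserves F (limit.isLimit (foldCospan q 2))).lift
    (WidePullbackShape.mkCone (F := foldCospan q 2 ⋙ F) (f ≫ F.map q)
      (fun i : Fin 2 => (![f, g] i : X ⟶ F.obj E)) (by
        intro i
        fin_cases i
        · rfl
        · exact h.symm))

end FoldPullback

section AdditiveBundle

variable {C : Type u} [Category.{v} C]

/-- `(q, z, s)` is an additive bundle, i.e. a commutative monoid in the slice category over `B`. -/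
structure IsAdditiveBundle {E B : C} (q : E ⟶ B) [∀ n, HasFoldPullback q n]
    (z : B ⟶ E) (s : foldPullback q 2 ⟶ E) : Prop where
  zero_proj : z ≫ q = 𝟙 B
  add_proj : s ≫ q = foldπ q 0 ≫ q
  add_comm : foldPair q (foldπ q (1 : Fin 2)) (foldπ q 0) (foldπ_comp q _ _) ≫ s = s
  add_assoc :
    foldPair q (foldPair q (foldπ q (0 : Fin 3)) (foldπ q 1) (foldπ_comp q _ _) ≫ s) (foldπ q 2)
        (by
          rw [Category.assoc, add_proj, ← Category.assoc, foldPair, WidePullback.lift_π]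
          exact foldπ_comp q _ _) ≫ s =
      foldPair q (foldπ q (0 : Fin 3)) (foldPair q (foldπ q 1) (foldπ q 2) (foldπ_comp q _ _) ≫ s)
        (by
          rw [Category.assoc, add_proj, ← Category.assoc (foldPair q _ _ _), foldPair,
            WidePullback.lift_π]
          exact foldπ_comp q _ _) ≫ s
  zero_add : foldPair q (q ≫ z) (𝟙 E) (by simp [zero_proj]) ≫ s = 𝟙 E

/-- `(f, g)` is an additive bundle morphism from `(q, z, s)` to `(F q', F z', F s')`, where `F`
preserves the pullback of `q'` along itself. -/
structure IsAdditiveBundleHom {E B E' B' : C} (F : C ⥤ C)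
    (q : E ⟶ B) [∀ n, HasFoldPullback q n] (z : B ⟶ E) (s : foldPullback q 2 ⟶ E)
    (q' : E' ⟶ B') [∀ n, HasFoldPullback q' n] [PreservesLimit (foldCospan q' 2) F]
    (z' : B' ⟶ E') (s' : foldPullback q' 2 ⟶ E')
    (f : B ⟶ F.obj B') (g : E ⟶ F.obj E') : Prop where
  proj : g ≫ F.map q' = q ≫ f
  zero : z ≫ g = f ≫ F.map z'
  add : mapPair F q' (foldπ q (0 : Fin 2) ≫ g) (foldπ q 1 ≫ g)
      (by
        rw [Category.assoc, Category.assoc, proj, ← Category.assoc, ← Category.assoc,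
          foldπ_comp q 0 1]) ≫ F.map s' = s ≫ g

end AdditiveBundle

section TangentStructure

variable (C : Type u) [Category.{v} C]

variable {C} in
/-- The iterate `Tᵏ = T ∘ ⋯ ∘ T` of an endofunctor. -/
def iter (T : C ⥤ C) : ℕ → (C ⥤ C)
  | 0 => 𝟭 C
  | k + 1 => iter T k ⋙ T

/-- An endofunctor `T` with a natural projection `p : T ⟶ 𝟭` all of whose `n`-fold pullbacks
along itself exist and are preserved by all iterates of `T`. -/
structure ProjectedEndofunctor where
  T : C ⥤ C
  p : T ⟶ 𝟭 C
  hasFoldPullback (M : C) (n : ℕ) : HasFoldPullback (B := M) (p.app M) n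
  preserves (M : C) (n k : ℕ) : PreservesLimit (foldCospan (B := M) (p.app M) n) (iter T k)

namespace ProjectedEndofunctor

variable {C} (P : ProjectedEndofunctor C)

/-- The component `p_M : T M ⟶ M` of the projection. -/
abbrev proj (M : C) : P.T.obj M ⟶ M := P.p.app M

instance (M : C) (n : ℕ) : HasFoldPullback (P.proj M) n := P.hasFoldPullback M n

instance (M : C) (n : ℕ) : PreservesLimit (foldCospan (P.proj M) n) P.T :=
  P.preserves M n 1

/-- The functor `Tₙ`, sending `M` to the `n`-fold pullback of `p_M` along itself. -/
def Tn (n : ℕ) : C ⥤ C where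
  obj M := foldPullback (P.proj M) n
  map {M N} f := foldMap (P.T.map f) f (P.p.naturality f) n
  map_id M := by
    apply WidePullback.hom_ext
    · intro j
      rw [foldMap, WidePullback.lift_π]
      simp
    · rw [foldMap, WidePullback.lift_base]
      simp
  map_comp f g := by
    apply WidePullback.hom_ext
    · intro j
      rw [foldMap, WidePullback.lift_π, Category.assoc, foldMap, foldMap, WidePullback.lift_π,
        ← Category.assoc, WidePullback.lift_π]
      simp
    · rw [foldMap, WidePullback.lift_base, Category.assoc, foldMap, foldMap,
        WidePullback.lift_base, WidePullback.lift_base_assoc]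
      simp

end ProjectedEndofunctor

/-- A tangent structure `(T, p, z, s, l, c)` on the category `C`. -/
structure TangentStructure where
  /-- tangent bundle functor and projection -/
  base : ProjectedEndofunctor C
  /-- zero morphism -/
  z : 𝟭 C ⟶ base.T
  /-- sum morphism -/
  s : base.Tn 2 ⟶ base.T
  /-- vertical lift -/
  l : base.T ⟶ base.T ⋙ base.T
  /-- canonical flip -/
  c : base.T ⋙ base.T ⟶ base.T ⋙ base.T
  additive (M : C) : IsAdditiveBundle (base.proj M) (z.app M) (s.app M)
  lift_additive (M : C) :
    IsAdditiveBundleHom base.T (base.proj M) (z.app M) (s.app M) (base.proj M) (z.app M) (s.app M)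
      (z.app M) (l.app M)
  flip_additive (M : C) :
    IsAdditiveBundleHom base.T (base.proj (base.T.obj M)) (z.app (base.T.obj M))
      (s.app (base.T.obj M))
      (base.proj M) (z.app M) (s.app M) (𝟙 (base.T.obj M)) (c.app M)
  lift_coassoc (M : C) : l.app M ≫ base.T.map (l.app M) = l.app M ≫ l.app (base.T.obj M)
  flip_flip (M : C) : c.app M ≫ c.app M = 𝟙 (base.T.obj (base.T.obj M))
  flip_yangBaxter (M : C) :
    base.T.map (c.app M) ≫ c.app (base.T.obj M) ≫ base.T.map (c.app M) =
      c.app (base.T.obj M) ≫ base.T.map (c.app M) ≫ c.app (base.T.obj M)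
  lift_flip (M : C) : l.app M ≫ c.app M = l.app M
  lift_flip_flip (M : C) :
    l.app (base.T.obj M) ≫ base.T.map (c.app M) ≫ c.app (base.T.obj M) =
      c.app M ≫ base.T.map (l.app M)
  lift_universal (M : C) :
    IsPullback
      (mapPair base.T (base.proj M) (foldπ (base.proj M) (0 : Fin 2) ≫ l.app M)
          (foldπ (base.proj M) 1 ≫ z.app (base.T.obj M))
          (by
            have h₁ := (lift_additive M).proj
            have h₂ : z.app (base.T.obj M) ≫ base.T.map (base.proj M) = base.proj M ≫ z.app M :=
              (z.naturality (base.proj M)).symm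
            rw [Category.assoc, Category.assoc, h₁, h₂, ← Category.assoc, ← Category.assoc,
              foldπ_comp (base.proj M) 0 1]) ≫ base.T.map (s.app M))
      (foldπ (base.proj M) (0 : Fin 2) ≫ base.proj M) (base.T.map (base.proj M)) (z.app M)

variable {C}

/-- The tangent bundle functor. -/
abbrev TangentStructure.T (𝕋 : TangentStructure C) : C ⥤ C := 𝕋.base.T

/-- The functor `Tₙ`, the `n`-fold fibre power of the tangent bundle functor. -/
abbrev TangentStructure.Tn (𝕋 : TangentStructure C) (n : ℕ) : C ⥤ C := 𝕋.base.Tn n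

/-- A tangent structure on a category with finite products is representable if for every positive
`n` the functor `Tₙ` is the exponential `(-)^{Dₙ}` by some object `Dₙ`, i.e. it is right adjoint
to `Dₙ × -`. -/
def TangentStructure.IsRepresentable [CartesianMonoidalCategory C] (𝕋 : TangentStructure C) :
    Prop :=
  ∀ n : ℕ, 0 < n → ∃ D : C, Nonempty (tensorLeft D ⊣ 𝕋.Tn n)

end TangentStructure

section Algebra

/-- The category of affine schemes over `R`, as the opposite of commutative `R`-algebras. Its
products are given by the tensor product of `R`-algebras. -/
abbrev Aff (R : Type u) [CommRing R] : Type (u + 1) := (CommAlgCat.{u} R)ᵒᵖ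

/-- The square-zero extension `R ⋉ M`, i.e. `R ⊕ M` with `(a + m)(b + n) = ab + an + bm`, as a
commutative `R`-algebra. -/
def squareZero (R : Type u) [CommRing R] (M : Type u) [AddCommGroup M] [Module R M] :
    CommAlgCat.{u} R :=
  letI : Module Rᵐᵒᵖ M := Module.compHom _ ((RingHom.id R).fromOpposite mul_comm)
  haveI : IsCentralScalar R M := ⟨fun _ _ => rfl⟩
  CommAlgCat.of R (TrivSqZeroExt R M)

/-- A non-unital `R`-algebra is solid if its multiplication `M ⊗ M ⟶ M` is an isomorphism. -/
def IsSolid (R : Type u) [CommRing R] (M : Type u) [NonUnitalCommRing M] [Module R M]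
    [IsScalarTower R M M] [SMulCommClass R M M] : Prop :=
  Function.Bijective (LinearMap.mul' R M)

end Algebra

end TangentCat

end

/-! Suppose `T` is right adjoint to `D ⊗ -` and let `A` be the algebra of `D`. The projection `p`
corresponds to natural maps `X ⟶ D ⊗ X`, split by the transpose of the zero section. A split natural
endomorphism of the identity of `Aff R` is trivial (`natEnd_eq_id`), so these maps come from a
single point of `D`, that is, from an augmentation `ε : A → R` (`inducedPoint_eq_lift`). Write `A =
R ⊕ I` with `I = ker ε`.

This splitting makes the fibre powers `Aₙ = R ⊕ Iⁿ` stable under base change, so the corresponding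
`Dₙ` represents `Tₙ` (`nonempty_foldAdjunction`). This settles the implication from the adjunction
to representability; conversely, representability at `n = 1` returns such a `D`, since `T₁ ≅ T`.

The tangent structure then constrains `A`. The sum gives an algebra map `A₂ → A` restricting to the
identity on both copies of `A`; products across the two copies of `I` vanish in `A₂`, hence `I² = 0`
and `A ≅ R ⋉ I`. Universality of the vertical lift identifies `A₂ = R ⊕ I ⊕ I` with the part `R ⊕ (I
⊗ 1) ⊕ (I ⊗ I)` of `A ⊗ A`, which forces `I ≅ I ⊗ I` (`exists_comparisons`,
`nonempty_tensor_augIdeal_equiv`).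

As a left adjoint, `D ⊗ -` preserves epimorphisms and coproducts, so `A` is flat and tensoring with
it commutes with powers of `R`; hence `A`, and its summand `I`, are finitely generated projective.
Finally, a finite module isomorphic to its tensor square is locally cyclic, so any such isomorphism
is automatically a commutative and associative multiplication, and `I` is solid. -/

noncomputable section

namespace TangentCat

open scoped TensorProduct

/-! ### Modules isomorphic to their tensor square -/

section LocallyCyclic

variable {R : Type u} [CommRing R] {M : Type u} [AddCommGroup M] [Module R M]

/-- A finite module isomorphic to its tensor square is locally cyclic. -/
theorem exists_smul_mem_span_singleton [Module.Finite R M] (e : M ⊗[R] M ≃ₗ[R] M)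
    (P : Ideal R) [P.IsMaximal] :
    ∃ (v : M) (r : R), r ∉ P ∧ ∀ m : M, r • m ∈ Submodule.span R {v} := by
  let _ := Ideal.Quotient.field P
  have e' : ((R ⧸ P) ⊗[R] M) ⊗[R ⧸ P] ((R ⧸ P) ⊗[R] M) ≃ₗ[R ⧸ P] (R ⧸ P) ⊗[R] M :=
    (TensorProduct.AlgebraTensorModule.distribBaseChange R (R ⧸ P) M M).symm ≪≫ₗ
      e.baseChange R (R ⧸ P) _ _
  -- The fibre dimension `d` at `P` satisfies `d * d = d`, so `d ≤ 1`.
  have h : Module.finrank (R ⧸ P) ((R ⧸ P) ⊗[R] M) ≤ 1 := by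
    have := e'.finrank_eq
    rw [Module.finrank_tensorProduct] at this
    by_contra! hn
    nlinarith
  obtain ⟨v', hv'⟩ := finrank_le_one_iff.mp h
  have hs : Function.Surjective (TensorProduct.mk R (R ⧸ P) M 1) :=
    TensorProduct.mk_surjective R M (R ⧸ P) Ideal.Quotient.mk_surjective
  obtain ⟨v, rfl⟩ := hs v'
  -- A generator of the fibre generates `M` modulo `P • M`; Nakayama then kills `M ⧸ span {v}` by
  -- some `r ≡ 1` modulo `P`.
  have hle : (⊤ : Submodule R (M ⧸ Submodule.span R {v})) ≤ P • ⊤ := by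
    rintro x -
    obtain ⟨m, rfl⟩ := Submodule.mkQ_surjective _ x
    obtain ⟨c, hc⟩ := hv' (TensorProduct.mk R (R ⧸ P) M 1 m)
    obtain ⟨c, rfl⟩ := Ideal.Quotient.mk_surjective c
    have hk : m - c • v ∈ P • (⊤ : Submodule R M) := by
      rw [← LinearMap.ker_tensorProductMk, LinearMap.mem_ker, map_sub, map_smul, ← hc, sub_eq_zero]
      rfl
    have : Submodule.mkQ (Submodule.span R {v}) m = Submodule.mkQ _ (m - c • v) := by
      rw [map_sub, map_smul]
      have : Submodule.mkQ (Submodule.span R {v}) v = 0 := by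
        simp
      rw [this, smul_zero, sub_zero]
    rw [this]
    have := Submodule.mem_map_of_mem (f := Submodule.mkQ (Submodule.span R {v})) hk
    rw [Submodule.map_smul''] at this
    exact Submodule.smul_mono le_rfl le_top this
  obtain ⟨r, hr, hr'⟩ := Submodule.exists_sub_one_mem_and_smul_eq_zero_of_fg_of_le_smul P _
    Module.Finite.fg_top hle
  refine ⟨v, r, fun hrP => ?_, fun m => ?_⟩
  · exact Ideal.one_notMem P (by simpa using P.sub_mem hrP hr)
  · have := hr' (Submodule.mkQ _ m) trivial
    rw [← map_smul] at this
    exact (Submodule.Quotient.mk_eq_zero _).mp this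

theorem eq_of_forall_maximal_smul_eq {x y : M}
    (h : ∀ P : Ideal R, P.IsMaximal → ∃ r ∉ P, r • x = r • y) : x = y := by
  rw [← sub_eq_zero]
  by_contra hne
  have : LinearMap.ker (LinearMap.toSpanSingleton R M (x - y)) ≠ ⊤ := by
    rw [Ne, Ideal.eq_top_iff_one]
    simpa using hne
  obtain ⟨P, hP, hle⟩ := Ideal.exists_le_maximal _ this
  obtain ⟨r, hr, hxy⟩ := h P hP
  exact hr (hle (by simp [smul_sub, hxy]))

/-- Near each maximal ideal both arguments become multiples of one `v`, and `v ⊗ v` is symmetric.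
Associativity below follows in the same way, using commutativity for `v` and `e (v ⊗ v)`. -/
theorem tensor_mul_comm [Module.Finite R M] (e : M ⊗[R] M ≃ₗ[R] M) (x y : M) :
    e (x ⊗ₜ y) = e (y ⊗ₜ x) := by
  refine eq_of_forall_maximal_smul_eq (R := R) fun P hP => ?_
  obtain ⟨v, r, hr, h⟩ := exists_smul_mem_span_singleton e P
  obtain ⟨a, ha⟩ := Submodule.mem_span_singleton.mp (h x)
  obtain ⟨b, hb⟩ := Submodule.mem_span_singleton.mp (h y)
  refine ⟨r * r, hP.isPrime.mul_notMem hr hr, ?_⟩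
  have h₁ : (r * r) • x ⊗ₜ[R] y = (r • x) ⊗ₜ[R] (r • y) := by
    rw [TensorProduct.smul_tmul_smul]
  have h₂ : (r * r) • y ⊗ₜ[R] x = (r • y) ⊗ₜ[R] (r • x) := by
    rw [TensorProduct.smul_tmul_smul]
  rw [← map_smul, ← map_smul, h₁, h₂, ← ha, ← hb, TensorProduct.smul_tmul_smul,
    TensorProduct.smul_tmul_smul, mul_comm]

theorem tensor_mul_assoc [Module.Finite R M] (e : M ⊗[R] M ≃ₗ[R] M) (x y z : M) :
    e (e (x ⊗ₜ y) ⊗ₜ z) = e (x ⊗ₜ e (y ⊗ₜ z)) := by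
  refine eq_of_forall_maximal_smul_eq (R := R) fun P hP => ?_
  obtain ⟨v, r, hr, h⟩ := exists_smul_mem_span_singleton e P
  obtain ⟨a, ha⟩ := Submodule.mem_span_singleton.mp (h x)
  obtain ⟨b, hb⟩ := Submodule.mem_span_singleton.mp (h y)
  obtain ⟨c, hc⟩ := Submodule.mem_span_singleton.mp (h z)
  refine ⟨r * r * r, hP.isPrime.mul_notMem (hP.isPrime.mul_notMem hr hr) hr, ?_⟩
  have h₁ : (r * r * r) • e (e (x ⊗ₜ y) ⊗ₜ z) = e (e ((r • x) ⊗ₜ (r • y)) ⊗ₜ (r • z)) := by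
    rw [TensorProduct.smul_tmul_smul, map_smul, TensorProduct.smul_tmul_smul, map_smul]
  have h₂ : (r * r * r) • e (x ⊗ₜ e (y ⊗ₜ z)) = e ((r • x) ⊗ₜ e ((r • y) ⊗ₜ (r • z))) := by
    rw [TensorProduct.smul_tmul_smul, map_smul, TensorProduct.smul_tmul_smul, map_smul, mul_assoc]
  rw [h₁, h₂, ← ha, ← hb, ← hc, TensorProduct.smul_tmul_smul, map_smul,
    TensorProduct.smul_tmul_smul, map_smul, TensorProduct.smul_tmul_smul, map_smul,
    TensorProduct.smul_tmul_smul, map_smul, tensor_mul_comm e (e (v ⊗ₜ v)), mul_assoc]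

/-- The multiplication on a module given by an isomorphism with its tensor square. -/
abbrev solidRing [Module.Finite R M] (e : M ⊗[R] M ≃ₗ[R] M) : NonUnitalCommRing M where
  mul x y := e (x ⊗ₜ y)
  left_distrib x y z := by
    change e _ = e _ + e _
    rw [TensorProduct.tmul_add, map_add]
  right_distrib x y z := by
    change e _ = e _ + e _
    rw [TensorProduct.add_tmul, map_add]
  zero_mul x := by
    change e _ = _
    rw [TensorProduct.zero_tmul, map_zero]
  mul_zero x := by
    change e _ = _
    rw [TensorProduct.tmul_zero, map_zero]
  mul_assoc := tensor_mul_assoc e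
  mul_comm := tensor_mul_comm e

/-- `R ⋉ M` sees only the module structure, so any property `Q` of it survives when `M` is equipped
with the multiplication `e`. -/
theorem exists_solid [Module.Finite R M] [Module.Projective R M] (e : M ⊗[R] M ≃ₗ[R] M)
    {Q : CommAlgCat.{u} R → Prop} (hQ : Q (squareZero R M)) :
    ∃ (M : Type u) (_ : NonUnitalCommRing M) (_ : Module R M)
        (_ : IsScalarTower R M M) (_ : SMulCommClass R M M),
        Module.Finite R M ∧ Module.Projective R M ∧ IsSolid R M ∧ Q (squareZero R M) := by
  let _ := solidRing e
  have h₁ : IsScalarTower R M M := ⟨fun r x y => by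
    change e ((r • x) ⊗ₜ y) = r • e (x ⊗ₜ y)
    rw [← map_smul, TensorProduct.smul_tmul']⟩
  have h₂ : SMulCommClass R M M := ⟨fun r x y => by
    change r • e (x ⊗ₜ y) = e (x ⊗ₜ (r • y))
    rw [← map_smul, TensorProduct.tmul_smul]⟩
  refine ⟨M, solidRing e, inferInstance, h₁, h₂, inferInstance, inferInstance, ?_, hQ⟩
  have : LinearMap.mul' R M = (e : M ⊗[R] M →ₗ[R] M) := by
    ext x y
    rfl
  rw [IsSolid, this]
  exact e.bijective

end LocallyCyclic

/-! ### Finite projectivity from flatness and powers of the base ring -/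

section FiniteProjective

variable {R : Type u} [CommRing R] {M : Type u} [AddCommGroup M] [Module R M]

/-- If `t = ∑ mᵢ ⊗ fᵢ` represents the identity, then `n = ∑ fᵢ(n) mᵢ` for every `n`, so the `mᵢ`
generate. -/
theorem finite_of_piScalarRightHom_eq_id {t : M ⊗[R] (M → R)}
    (ht : TensorProduct.piScalarRightHom R R M M t = id) : Module.Finite R M := by
  classical
  obtain ⟨s, rfl⟩ := TensorProduct.exists_finset t
  refine ⟨⟨s.image Prod.fst, top_unique fun n _ => ?_⟩⟩
  have := congrFun ht n
  simp only [map_sum, Finset.sum_apply, TensorProduct.piScalarRightHom_tmul, id] at this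
  rw [← this]
  refine Submodule.sum_mem _ fun i hi => Submodule.smul_mem _ _ (Submodule.subset_span ?_)
  simpa using ⟨_, hi⟩

/-- A flat module whose tensor product commutes with powers of the base ring is finitely
generated projective. -/
theorem finite_projective_of_flat [Module.Flat R M]
    (h : ∀ X : Type u, Function.Bijective (TensorProduct.piScalarRightHom R R M X)) :
    Module.Finite R M ∧ Module.Projective R M := by
  have hfin : Module.Finite R M :=
    finite_of_piScalarRightHom_eq_id ((h M).2 id).choose_spec
  refine ⟨hfin, ?_⟩
  obtain ⟨n, f, hf⟩ := Module.Finite.exists_fin' R M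
  have hK : (LinearMap.ker f).FG := by
    let K := LinearMap.ker f
    have hex : Function.Exact (K.subtype.rTensor (K → R)) (f.rTensor (K → R)) :=
      rTensor_exact _ (LinearMap.exact_subtype_ker_map f) hf
    -- `w` represents the inclusion of `K` in `Rⁿ`. It dies in `M ⊗ R^K`, hence lifts to `K ⊗ R^K`,
    -- where it represents the identity of `K`; so `K` is finitely generated and `M` finitely
    -- presented.
    let w : (Fin n → R) ⊗[R] (K → R) :=
      ∑ i, Pi.single i 1 ⊗ₜ (fun x : K => (x : Fin n → R) i)
    have hw : TensorProduct.piScalarRightHom R R (Fin n → R) K w =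
        fun x : K => (x : Fin n → R) := by
      ext x i
      simp [w, Pi.single_apply]
    have nat : ∀ {N N' : Type u} [AddCommGroup N] [Module R N] [AddCommGroup N'] [Module R N']
        (g : N →ₗ[R] N') (t : N ⊗[R] (K → R)) (x : K),
        TensorProduct.piScalarRightHom R R N' K (g.rTensor _ t) x =
          g (TensorProduct.piScalarRightHom R R N K t x) := by
      intro N N' _ _ _ _ g t x
      induction t with
      | zero => simp
      | tmul a b => simp
      | add a b ha hb => simp [ha, hb]
    have hw0 : f.rTensor (K → R) w = 0 := by
      apply (h K).1
      ext x
      rw [nat, hw]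
      simp
    obtain ⟨t, ht⟩ := (hex w).mp hw0
    refine Module.Finite.iff_fg.mp (finite_of_piScalarRightHom_eq_id (t := t) ?_)
    ext x : 1
    apply Subtype.ext
    have := nat K.subtype t x
    rw [ht, hw] at this
    exact this.symm
  have := Module.finitePresentation_of_surjective f hf hK
  exact Module.Flat.projective_of_finitePresentation

end FiniteProjective

/-! ### Augmented algebras and square-zero extensions -/

section SquareZero

variable {R : Type u} [CommRing R] {A : Type u} [CommRing A] [Algebra R A]

/-- The projection of an augmented algebra onto its augmentation ideal. -/
def augProj (ε : A →ₐ[R] R) : A →ₗ[R] LinearMap.ker ε.toLinearMap :=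
  LinearMap.codRestrict _ (LinearMap.id - Algebra.linearMap R A ∘ₗ ε.toLinearMap) fun a => by
    simp

@[simp]
theorem coe_augProj (ε : A →ₐ[R] R) (a : A) : (augProj ε a : A) = a - algebraMap R A (ε a) := rfl

/-- An augmented algebra whose augmentation ideal squares to zero is a square-zero extension. -/
def isoSquareZero (ε : A →ₐ[R] R) (h : ∀ x y : A, ε x = 0 → ε y = 0 → x * y = 0) :
    CommAlgCat.of R A ≅ squareZero R (LinearMap.ker ε.toLinearMap) :=
  letI : Module Rᵐᵒᵖ (LinearMap.ker ε.toLinearMap) :=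
    Module.compHom _ ((RingHom.id R).fromOpposite mul_comm)
  haveI : IsCentralScalar R (LinearMap.ker ε.toLinearMap) := ⟨fun _ _ => rfl⟩
  CommAlgCat.isoMk (Y := TrivSqZeroExt R (LinearMap.ker ε.toLinearMap)) <| AlgEquiv.ofBijective
    (AlgHom.ofLinearMap
      { toFun a := (TrivSqZeroExt.inl (ε a) + TrivSqZeroExt.inr (augProj ε a) :
          TrivSqZeroExt R (LinearMap.ker ε.toLinearMap))
        map_add' a b := by
          ext <;> simp
        map_smul' r a := by
          ext <;> simp }
      (by ext <;> simp)
      (fun a b => by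
        ext
        · simp
        · have := h (a - algebraMap R A (ε a)) (b - algebraMap R A (ε b)) (by simp) (by simp)
          simp [Algebra.smul_def]
          linear_combination this))
    ⟨fun a b hab => by
      have h₁ := congrArg TrivSqZeroExt.fst hab
      have h₂ := congrArg
        (fun x : TrivSqZeroExt R (LinearMap.ker ε.toLinearMap) => (x.snd : A)) hab
      simp at h₁ h₂
      simpa [h₁] using h₂, fun x => ⟨algebraMap R A x.fst + x.snd, by
        have hx : ε (x.snd : A) = 0 := x.snd.2
        ext <;> simp [hx]⟩⟩

end SquareZero

/-! ### Fibre powers of an augmented algebra and their base change -/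

section FoldAlgebra

variable {R : Type u} [CommRing R] {A : Type u} [CommRing A] [Algebra R A]

/-- The base change of an augmentation. -/
def augBaseChange (ε : A →ₐ[R] R) (B : Type u) [CommRing B] [Algebra R B] : A ⊗[R] B →ₐ[R] B :=
  (Algebra.TensorProduct.lid R B).toAlgHom.comp (Algebra.TensorProduct.map ε (AlgHom.id R B))

@[simp]
theorem augBaseChange_tmul (ε : A →ₐ[R] R) (B : Type u) [CommRing B] [Algebra R B] (a : A) (b : B) :
    augBaseChange ε B (a ⊗ₜ b) = ε a • b := rfl

/-- The `n`-fold fibre power of an augmented algebra over the base ring. -/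
def foldAlg (ε : A →ₐ[R] R) (n : ℕ) : Subalgebra R (R × (Fin n → A)) where
  carrier := {x | ∀ i, ε (x.2 i) = x.1}
  mul_mem' ha hb i := by simp [ha i, hb i]
  add_mem' ha hb i := by simp [ha i, hb i]
  algebraMap_mem' r i := by simp

variable (ε : A →ₐ[R] R) (n : ℕ)

/-- The augmentation of the `n`-fold fibre power. -/
def foldAlgBase : foldAlg ε n →ₐ[R] R := (AlgHom.fst R R (Fin n → A)).comp (foldAlg ε n).val

/-- The projections of the `n`-fold fibre power. -/
def foldAlgProj (i : Fin n) : foldAlg ε n →ₐ[R] A :=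
  ((Pi.evalAlgHom R (fun _ => A) i).comp (AlgHom.snd R R (Fin n → A))).comp (foldAlg ε n).val

theorem comp_foldAlgProj (i : Fin n) : ε.comp (foldAlgProj ε n i) = foldAlgBase ε n :=
  AlgHom.ext fun x => x.2 i

variable {n} in
/-- The inclusion of the augmentation ideal in a component of the `n`-fold fibre power. -/
def foldAlgSingle (i : Fin n) : A →ₗ[R] foldAlg ε n :=
  LinearMap.codRestrict (Subalgebra.toSubmodule (foldAlg ε n))
    (LinearMap.inr R R (Fin n → A) ∘ₗ LinearMap.single R (fun _ => A) i ∘ₗ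
      Submodule.subtype _ ∘ₗ augProj ε) fun a j => by
    by_cases h : j = i
    · subst h; simp
    · simp [Pi.single_eq_of_ne h]

variable {n} in
@[simp]
theorem coe_foldAlgSingle (i : Fin n) (a : A) :
    (foldAlgSingle ε i a : R × (Fin n → A)) = (0, Pi.single i (a - algebraMap R A (ε a))) := rfl

variable (B : Type u) [CommRing B] [Algebra R B]

/-- The comparison of the base change of a fibre power with the fibre power of the base change. -/
def foldComparison : foldAlg ε n ⊗[R] B →ₐ[R] B × (Fin n → A ⊗[R] B) :=
  AlgHom.prod (augBaseChange (foldAlgBase ε n) B)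
    (AlgHom.pi fun i => Algebra.TensorProduct.map (foldAlgProj ε n i) (AlgHom.id R B))

/-- A linear inverse of `foldComparison`. -/
def foldComparisonInv : B × (Fin n → A ⊗[R] B) →ₗ[R] foldAlg ε n ⊗[R] B :=
  LinearMap.coprod (TensorProduct.mk R (foldAlg ε n) B 1)
    (LinearMap.lsum R (fun _ => A ⊗[R] B) R fun i => (foldAlgSingle ε i).rTensor B)

theorem foldComparisonInv_foldComparison (t : foldAlg ε n ⊗[R] B) :
    foldComparisonInv ε n B (foldComparison ε n B t) = t := by
  suffices h : foldComparisonInv ε n B ∘ₗ (foldComparison ε n B).toLinearMap = LinearMap.id from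
    LinearMap.congr_fun h t
  ext x b
  -- The decomposition `R ⊕ Iⁿ` of the fibre power.
  have hx : x = foldAlgBase ε n x • (1 : foldAlg ε n) +
      ∑ i, foldAlgSingle ε i (foldAlgProj ε n i x) := by
    apply Subtype.ext
    have h := x.2
    ext i
    · simp [foldAlgBase, Prod.fst_sum]
    · simp [foldAlgBase, foldAlgProj, Prod.snd_sum, Finset.sum_apply, h _,
        Finset.sum_pi_single, Algebra.smul_def]
  change foldComparisonInv ε n B (foldComparison ε n B (x ⊗ₜ b)) = x ⊗ₜ b
  conv_rhs => rw [hx]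
  rw [TensorProduct.add_tmul, TensorProduct.sum_tmul, TensorProduct.smul_tmul]
  simp [foldComparison, foldComparisonInv]

/-- With its companion above, this identifies `foldAlg ε n ⊗ B` with the fibre power of `A ⊗ B` over
`B`: the splitting `A = R ⊕ I` survives tensoring, so no flatness of `B` is needed. -/
theorem foldComparison_foldComparisonInv (x : B × (Fin n → A ⊗[R] B))
    (hx : ∀ i, augBaseChange ε B (x.2 i) = x.1) :
    foldComparison ε n B (foldComparisonInv ε n B x) = x := by
  have key₁ : ∀ (i : Fin n) (c : A ⊗[R] B),
      augBaseChange (foldAlgBase ε n) B ((foldAlgSingle ε i).rTensor B c) = 0 := by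
    intro i c
    induction c with
    | zero => simp
    | tmul a b => simp [foldAlgBase]
    | add a b ha hb => simp [ha, hb]
  have key₂ : ∀ (i j : Fin n) (c : A ⊗[R] B),
      Algebra.TensorProduct.map (foldAlgProj ε n j) (AlgHom.id R B)
        ((foldAlgSingle ε i).rTensor B c) =
      if j = i then c - 1 ⊗ₜ augBaseChange ε B c else 0 := by
    intro i j c
    induction c with
    | zero => simp
    | tmul a b =>
      split_ifs with h
      · subst h
        simp [foldAlgProj, TensorProduct.sub_tmul, Algebra.algebraMap_eq_smul_one,
          TensorProduct.smul_tmul]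
      · simp [foldAlgProj, Pi.single_eq_of_ne h]
    | add a b ha hb =>
      rw [map_add, map_add, ha, hb]
      split_ifs with h
      · rw [map_add, TensorProduct.tmul_add]; abel
      · simp
  ext i
  · simp [foldComparison, foldComparisonInv, key₁]
  · simp [foldComparison, foldComparisonInv, key₂, hx]

theorem foldComparison_injective : Function.Injective (foldComparison ε n B) :=
  Function.LeftInverse.injective (foldComparisonInv_foldComparison ε n B)

variable {B} in
theorem exists_foldAlg_lift {C : Type u} [CommRing C] [Algebra R C] (β : C →ₐ[R] B)
    (γ : Fin n → (C →ₐ[R] A ⊗[R] B)) (h : ∀ i, (augBaseChange ε B).comp (γ i) = β) :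
    ∃ φ : C →ₐ[R] foldAlg ε n ⊗[R] B, (augBaseChange (foldAlgBase ε n) B).comp φ = β ∧
      ∀ i, (Algebra.TensorProduct.map (foldAlgProj ε n i) (AlgHom.id R B)).comp φ = γ i := by
  have hφ : ∀ c, (AlgHom.prod β (AlgHom.pi γ)) c ∈ (foldComparison ε n B).range := fun c =>
    ⟨_, foldComparison_foldComparisonInv ε n B _ fun i => congr($(h i) c)⟩
  let φ := (AlgEquiv.ofInjective _ (foldComparison_injective ε n B)).symm.toAlgHom.comp
    ((AlgHom.prod β (AlgHom.pi γ)).codRestrict _ hφ)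
  have : ∀ c, foldComparison ε n B (φ c) = (β c, fun i => γ i c) := fun c => by
    have := (AlgEquiv.ofInjective _ (foldComparison_injective ε n B)).apply_symm_apply
      ((AlgHom.prod β (AlgHom.pi γ)).codRestrict _ hφ c)
    exact congrArg Subtype.val this
  exact ⟨φ, AlgHom.ext fun c => congrArg Prod.fst (this c),
    fun i => AlgHom.ext fun c => congrFun (congrArg Prod.snd (this c)) i⟩

end FoldAlgebra

/-! ### Natural endomorphisms of the identity functor -/

section NatEnd

open Polynomial

/-- With `a` the linear coefficient of `f`, comparing coefficients of `t` in `f(st) = f(s) f(t)`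
gives `a s = a f(s)`, and differentiating `f(h) = X` at `0` shows that `a` is a unit. Some splitting
is needed: Frobenius gives `f = X ^ p` over `𝔽_p`. -/
theorem eq_X_of_comp_eq_X {R : Type u} [CommRing R] {f h : R[X]}
    (hf : (f.map C).comp (C X * X) = C f * f.map C) (hh0 : h.coeff 0 = 0)
    (hfh : f.comp h = X) : f = X := by
  have h₁ : f.coeff 1 * h.coeff 1 = 1 := by
    have := congrArg (fun q => (derivative q).eval 0) hfh
    simpa [derivative_comp, ← coeff_zero_eq_eval_zero, hh0, coeff_derivative, mul_comm,
      eval_comp] using this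
  have h₂ := congrArg (fun q => q.coeff 1) hf
  simp only [comp_C_mul_X_coeff, coeff_map, coeff_C_mul, pow_one] at h₂
  calc f = f * C (f.coeff 1) * C (h.coeff 1) := by
        rw [mul_assoc, ← C_mul, h₁, C_1, mul_one]
    _ = X * (C (f.coeff 1) * C (h.coeff 1)) := by rw [← h₂]; ring
    _ = X := by rw [← C_mul, h₁, C_1, mul_one]

variable {R : Type u} [CommRing R]

/-- A split endomorphism of the identity functor on affine schemes is trivial. -/
theorem natEnd_eq_id {F H : 𝟭 (Aff R) ⟶ 𝟭 (Aff R)} (h : F ≫ H = 𝟙 _) : F = 𝟙 _ := by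
  have key : ∀ (F : 𝟭 (Aff R) ⟶ 𝟭 (Aff R)) (B : Type u) [CommRing B] [Algebra R B] (b : B),
      (F.app (op (CommAlgCat.of R B))).unop.hom b =
        aeval b ((F.app (op (CommAlgCat.of R R[X]))).unop.hom X : R[X]) := by
    intro F B _ _ b
    have := F.naturality (CommAlgCat.ofHom (aeval (R := R) b)).op
    have := congr(($this).unop.hom X)
    simpa using this.symm
  have key' : ∀ (F : 𝟭 (Aff R) ⟶ 𝟭 (Aff R)),
      ((F.app (op (CommAlgCat.of R R[X]))).unop.hom X : R[X]).coeff 0 = 0 := by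
    intro F
    have := key F R 0
    rw [map_zero] at this
    simpa [coeff_zero_eq_aeval_zero] using this.symm
  have hX : ((F.app (op (CommAlgCat.of R R[X]))).unop.hom X : R[X]) = X := by
    refine eq_X_of_comp_eq_X (h := ((H.app (op (CommAlgCat.of R R[X]))).unop.hom X : R[X])) ?_
      (key' H) ?_
    -- Multiplicativity of `F` is tested on a product of two independent variables.
    · have h₁ := key F R[X][X] (C X * X)
      have h₂ := key F R[X][X] (C X)
      have h₃ := key F R[X][X] X
      rw [map_mul, h₂, h₃] at h₁
      have e₁ : ∀ q : R[X], aeval (C X : R[X][X]) q = C q := fun q => by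
        have : (C X : R[X][X]) = (CAlgHom : R[X] →ₐ[R] R[X][X]) X := rfl
        rw [this, aeval_algHom_apply, aeval_X_left_apply]; rfl
      have e₂ : ∀ (t : R[X][X]) (q : R[X]), aeval t q = (q.map C).comp t := fun t q => by
        rw [comp, eval₂_map, aeval_def]; rfl
      rw [e₁, e₂, e₂, comp_X] at h₁
      exact h₁.symm
    · have := congr(($h).app (op (CommAlgCat.of R R[X])) |>.unop.hom X)
      simp only [NatTrans.comp_app, unop_comp, CommAlgCat.hom_comp] at this
      refine Eq.trans ?_ this
      refine Eq.trans ?_ (key F R[X] _).symm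
      rfl
  ext X
  apply Quiver.Hom.unop_inj
  ext b
  refine (key F _ b).trans ?_
  rw [hX, aeval_X]
  rfl

end NatEnd

/-! ### Natural split maps into a product come from a point -/

section Augmentation

open CartesianMonoidalCategory

variable {C : Type*} [Category C] [CartesianMonoidalCategory C] {D : C}

/-- By naturality along `X ⟶ 𝟙_`, the first component of `e` is constant. The second is an
endomorphism `F` of the identity functor; inserting the constant point and applying `ζ` gives `H`
with `F ≫ H = e ≫ ζ = 𝟙`, so `F` is trivial. -/
theorem augmentation_eq_lift (hC : ∀ F H : 𝟭 C ⟶ 𝟭 C, F ≫ H = 𝟙 _ → F = 𝟙 _)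
    (e : ∀ X : C, X ⟶ D ⊗ X) (ζ : ∀ X : C, D ⊗ X ⟶ X)
    (he : ∀ {X Y : C} (f : X ⟶ Y), f ≫ e Y = e X ≫ D ◁ f)
    (hζ : ∀ {X Y : C} (f : X ⟶ Y), D ◁ f ≫ ζ Y = ζ X ≫ f)
    (h : ∀ X, e X ≫ ζ X = 𝟙 X) (X : C) :
    e X = lift (toUnit X ≫ e (𝟙_ _) ≫ fst D (𝟙_ _)) (𝟙 X) := by
  have hfst : ∀ X, e X ≫ fst D X = toUnit X ≫ e (𝟙_ _) ≫ fst D (𝟙_ _) := fun X => by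
    rw [reassoc_of% he (toUnit X), whiskerLeft_fst]
  have hk : ∀ {X Y : C} (f : X ⟶ Y) (k : 𝟙_ C ⟶ D), f ≫ lift (toUnit Y ≫ k) (𝟙 Y) =
      lift (toUnit X ≫ k) f := fun f k => by
    rw [comp_lift, Category.comp_id, ← Category.assoc, comp_toUnit]
  have hk' : ∀ {X Y : C} (f : X ⟶ Y) (k : 𝟙_ C ⟶ D), lift (toUnit X ≫ k) (𝟙 X) ≫ D ◁ f =
      lift (toUnit X ≫ k) f := fun f k => by
    rw [lift_whiskerLeft, Category.id_comp]
  let F : 𝟭 C ⟶ 𝟭 C :=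
    { app X := e X ≫ snd D X
      naturality X Y f := by
        change f ≫ e Y ≫ snd D Y = (e X ≫ snd D X) ≫ f
        rw [reassoc_of% he f, whiskerLeft_snd, Category.assoc] }
  let H : 𝟭 C ⟶ 𝟭 C :=
    { app X := lift (toUnit X ≫ e (𝟙_ _) ≫ fst D (𝟙_ _)) (𝟙 X) ≫ ζ X
      naturality X Y f := by
        change f ≫ lift (toUnit Y ≫ e (𝟙_ _) ≫ fst D (𝟙_ _)) (𝟙 Y) ≫ ζ Y =
          (lift (toUnit X ≫ e (𝟙_ _) ≫ fst D (𝟙_ _)) (𝟙 X) ≫ ζ X) ≫ f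
        rw [Category.assoc, ← hζ, ← Category.assoc f, hk, ← hk', Category.assoc] }
  have hF : F = 𝟙 _ := by
    refine hC F H ?_
    ext X : 2
    refine Eq.trans ?_ (h X)
    change (e X ≫ snd D X) ≫ lift (toUnit X ≫ e (𝟙_ _) ≫ fst D (𝟙_ _)) (𝟙 X) ≫ ζ X = _
    rw [← Category.assoc (e X ≫ snd D X), hk, ← hfst, ← comp_lift, lift_fst_snd, Category.comp_id]
  refine CartesianMonoidalCategory.hom_ext _ _ ?_ ?_
  · rw [lift_fst, hfst]
  · rw [lift_snd]
    exact congr(($hF).app X)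

end Augmentation

/-! ### Functoriality of fold pullbacks -/

section FoldMap

universe v

variable {C : Type u} [Category.{v} C] {E B E' B' : C} {q : E ⟶ B} {q' : E' ⟶ B'}
  (f : E ⟶ E') (g : B ⟶ B') (h : f ≫ q' = q ≫ g) (n : ℕ) [HasFoldPullback q n]
  [HasFoldPullback q' n]

theorem foldMap_π (i : Fin n) : foldMap f g h n ≫ foldπ q' i = foldπ q i ≫ f :=
  WidePullback.lift_π _ _ _ _ _

theorem foldMap_base : foldMap f g h n ≫ WidePullback.base (fun _ : Fin n => q') =
    WidePullback.base (fun _ : Fin n => q) ≫ g :=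
  WidePullback.lift_base _ _ _ _

end FoldMap

/-! ### Transposing the projection and the zero section -/

section Transpose

open CartesianMonoidalCategory

universe v

variable {C : Type u} [Category.{v} C] [CartesianMonoidalCategory C] {D : C} {T : C ⥤ C}
  (adj : tensorLeft D ⊣ T)

/-- Transposition along an adjunction `D ⊗ - ⊣ T`. -/
def transpose (X M : C) : (D ⊗ X ⟶ M) ≃ (X ⟶ T.obj M) := adj.homEquiv X M

theorem transpose_comp {X M N : C} (φ : D ⊗ X ⟶ M) (g : M ⟶ N) :
    transpose adj X N (φ ≫ g) = transpose adj X M φ ≫ T.map g :=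
  adj.homEquiv_naturality_right φ g

theorem transpose_whiskerLeft_comp {X Y M : C} (f : X ⟶ Y) (φ : D ⊗ Y ⟶ M) :
    transpose adj X M (D ◁ f ≫ φ) = f ≫ transpose adj Y M φ :=
  adj.homEquiv_naturality_left f φ

theorem transpose_symm_comp_map {X M N : C} (f : X ⟶ T.obj M) (g : M ⟶ N) :
    (transpose adj X N).symm (f ≫ T.map g) = (transpose adj X M).symm f ≫ g :=
  adj.homEquiv_naturality_right_symm f g

theorem transpose_symm_comp {X Y M : C} (f : X ⟶ Y) (g : Y ⟶ T.obj M) :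
    (transpose adj X M).symm (f ≫ g) = D ◁ f ≫ (transpose adj Y M).symm g :=
  adj.homEquiv_naturality_left_symm f g

variable (p : T ⟶ 𝟭 C)

/-- The natural transformation `X ⟶ D ⊗ X` induced by a projection `T ⟶ 𝟭`. -/
def inducedPoint (X : C) : X ⟶ D ⊗ X := transpose adj X (D ⊗ X) (𝟙 _) ≫ p.app (D ⊗ X)

/-- Projecting a tangent vector to its base point is, on transposes, restriction along
`inducedPoint`. -/
theorem transpose_comp_proj {X M : C} (φ : D ⊗ X ⟶ M) :
    transpose adj X M φ ≫ p.app M = inducedPoint adj p X ≫ φ := by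
  have h : T.map φ ≫ p.app M = p.app (D ⊗ X) ≫ φ := p.naturality φ
  rw [inducedPoint, Category.assoc, ← h, ← Category.assoc, ← transpose_comp, Category.id_comp]

theorem comp_inducedPoint {X Y : C} (f : X ⟶ Y) :
    f ≫ inducedPoint adj p Y = inducedPoint adj p X ≫ D ◁ f := by
  rw [← transpose_comp_proj, inducedPoint, ← Category.assoc, ← transpose_whiskerLeft_comp,
    Category.comp_id]

/-- The retraction required by `augmentation_eq_lift` is the transpose of the zero section. -/
theorem inducedPoint_eq_lift (hC : ∀ F H : 𝟭 C ⟶ 𝟭 C, F ≫ H = 𝟙 _ → F = 𝟙 _)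
    (z : 𝟭 C ⟶ T) (hz : ∀ X, z.app X ≫ p.app X = 𝟙 X) (X : C) :
    inducedPoint adj p X =
      lift (toUnit X ≫ inducedPoint adj p (𝟙_ _) ≫ fst D (𝟙_ _)) (𝟙 X) := by
  refine augmentation_eq_lift hC _ (fun X => (transpose adj X X).symm (z.app X))
    (comp_inducedPoint adj p) (fun {X Y} f => ?_) (fun X => ?_) X
  · have h : f ≫ z.app Y = z.app X ≫ T.map f := z.naturality f
    rw [← transpose_symm_comp, h, transpose_symm_comp_map]
  · rw [← transpose_comp_proj, Equiv.apply_symm_apply, hz]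

end Transpose

/-! ### Representing the fibre powers of the tangent functor -/

section FoldAdjunction

open CartesianMonoidalCategory

universe v

variable {C : Type u} [Category.{v} C] [CartesianMonoidalCategory C] {D : C}
  (P : ProjectedEndofunctor C) (adj : tensorLeft D ⊣ P.T)

/-- If `T` is right adjoint to `D ⊗ -` and `Dₙ` is a stable `n`-fold fibre power of `D`, then `Tₙ`
is right adjoint to `Dₙ ⊗ -`. -/
theorem nonempty_foldAdjunction (n : ℕ) {Dn : C} (b : 𝟙_ C ⟶ Dn) (k : Fin n → (D ⟶ Dn))
    (hk : ∀ X i, inducedPoint adj P.p X ≫ k i ▷ X = lift (toUnit X ≫ b) (𝟙 X))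
    (huniq : ∀ {X M : C} (φ ψ : Dn ⊗ X ⟶ M),
      lift (toUnit X ≫ b) (𝟙 X) ≫ φ = lift (toUnit X ≫ b) (𝟙 X) ≫ ψ →
      (∀ i, k i ▷ X ≫ φ = k i ▷ X ≫ ψ) → φ = ψ)
    (hex : ∀ {X M : C} (β : X ⟶ M) (γ : Fin n → (D ⊗ X ⟶ M)),
      (∀ i, inducedPoint adj P.p X ≫ γ i = β) →
      ∃ φ : Dn ⊗ X ⟶ M, lift (toUnit X ≫ b) (𝟙 X) ≫ φ = β ∧ ∀ i, k i ▷ X ≫ φ = γ i) :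
    Nonempty (tensorLeft Dn ⊣ P.Tn n) := by
  -- The hypotheses say that `Dn ⊗ X` is the pushout of `n` copies of `D ⊗ X` under `X`; so a map
  -- out of it is a family of tangent vectors with common base point. The base leg is kept
  -- separately, which also covers `n = 0`.
  let f (X M : C) (φ : Dn ⊗ X ⟶ M) : X ⟶ foldPullback (P.proj M) n :=
    WidePullback.lift (lift (toUnit X ≫ b) (𝟙 X) ≫ φ) (fun i => transpose adj X M (k i ▷ X ≫ φ))
      (fun i => by rw [transpose_comp_proj, ← hk X i, Category.assoc])
  have f_base : ∀ (X M : C) (φ : Dn ⊗ X ⟶ M),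
      f X M φ ≫ WidePullback.base _ = lift (toUnit X ≫ b) (𝟙 X) ≫ φ :=
    fun X M φ => WidePullback.lift_base _ _ _ _
  have f_π : ∀ (X M : C) (φ : Dn ⊗ X ⟶ M) (i : Fin n),
      f X M φ ≫ foldπ (P.proj M) i = transpose adj X M (k i ▷ X ≫ φ) :=
    fun X M φ i => WidePullback.lift_π _ _ _ _ _
  have hf : ∀ X M, Function.Bijective (f X M) := fun X M => by
    constructor
    · intro φ ψ h
      refine huniq _ _ ?_ fun i => ?_
      · rw [← f_base, h, f_base]
      · apply (transpose adj X M).injective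
        rw [← f_π, h, f_π]
    · intro t
      obtain ⟨φ, h₁, h₂⟩ := hex (t ≫ WidePullback.base _)
        (fun i => (transpose adj X M).symm (t ≫ foldπ (P.proj M) i)) (fun i => by
          rw [← transpose_comp_proj, Equiv.apply_symm_apply, Category.assoc]
          congr 1
          exact WidePullback.π_arrow (fun _ : Fin n => P.proj M) i)
      refine ⟨φ, WidePullback.hom_ext _ _ _ (fun i => ?_) ?_⟩
      · rw [f_π, h₂, Equiv.apply_symm_apply]
      · rw [f_base, h₁]
  have hleft : ∀ {X' X M : C} (g : X' ⟶ X) (φ : Dn ⊗ X ⟶ M),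
      f X' M (Dn ◁ g ≫ φ) = g ≫ f X M φ := fun {X' X M} g φ => by
    refine WidePullback.hom_ext _ _ _ (fun i => ?_) ?_
    · rw [f_π, Category.assoc, f_π, ← transpose_whiskerLeft_comp, ← whisker_exchange_assoc]
    · rw [f_base, Category.assoc, f_base, ← Category.assoc, ← Category.assoc]
      congr 1
      rw [lift_whiskerLeft, comp_lift, Category.id_comp, Category.comp_id, ← Category.assoc,
        comp_toUnit]
  have hright : ∀ {X M N : C} (φ : Dn ⊗ X ⟶ M) (g : M ⟶ N),
      f X N (φ ≫ g) = f X M φ ≫ foldMap (P.T.map g) g (P.p.naturality g) n := fun {X M N} φ g => by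
    refine WidePullback.hom_ext _ _ _ (fun i => ?_) ?_
    · rw [f_π, Category.assoc, foldMap_π, ← Category.assoc (f X M φ), f_π, ← transpose_comp,
        Category.assoc]
    · rw [f_base, Category.assoc, foldMap_base, ← Category.assoc (f X M φ), f_base, Category.assoc]
  exact ⟨Adjunction.mkOfHomEquiv
    { homEquiv X M := Equiv.ofBijective (f X M) (hf X M)
      homEquiv_naturality_left_symm {X' X M} g t := by
        rw [Equiv.symm_apply_eq]
        refine Eq.trans ?_ (hleft g _).symm
        congr 1
        exact (Equiv.apply_symm_apply (Equiv.ofBijective (f X M) (hf X M)) t).symm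
      homEquiv_naturality_right φ g := hright φ g }⟩

end FoldAdjunction

/-! ### From the adjunction to representability -/

section Affine

open CartesianMonoidalCategory

variable {R : Type u} [CommRing R]

theorem lift_toUnit_comp_unop_hom {D X : Aff R} (b : 𝟙_ (Aff R) ⟶ D) :
    (lift (toUnit X ≫ b) (𝟙 X)).unop.hom = augBaseChange (b.unop.hom : D.unop →ₐ[R] R) X.unop := by
  refine Algebra.TensorProduct.ext' fun a x => ?_
  exact (Algebra.smul_def _ _).symm

theorem isRepresentable_of_adjunction (𝕋 : TangentStructure (Aff R)) {D : Aff R}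
    (adj : tensorLeft D ⊣ 𝕋.T) : 𝕋.IsRepresentable := by
  intro n _
  let b₀ : 𝟙_ (Aff R) ⟶ D := inducedPoint adj 𝕋.base.p (𝟙_ _) ≫ fst D (𝟙_ _)
  let ε : D.unop →ₐ[R] R := b₀.unop.hom
  have he : ∀ X, inducedPoint adj 𝕋.base.p X = lift (toUnit X ≫ b₀) (𝟙 X) :=
    inducedPoint_eq_lift adj 𝕋.base.p (fun F H => natEnd_eq_id) 𝕋.z
      (fun X => (𝕋.additive X).zero_proj)
  let Dn : Aff R := op (CommAlgCat.of R (foldAlg ε n))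
  let b : 𝟙_ (Aff R) ⟶ Dn := (CommAlgCat.ofHom (foldAlgBase ε n)).op
  let k (i : Fin n) : D ⟶ Dn := (CommAlgCat.ofHom (foldAlgProj ε n i)).op
  have hk₀ : ∀ i, b₀ ≫ k i = b := fun i =>
    Quiver.Hom.unop_inj (CommAlgCat.hom_ext (comp_foldAlgProj ε n i))
  have hb : ∀ X : Aff R, (lift (toUnit X ≫ b) (𝟙 X)).unop.hom =
      augBaseChange (foldAlgBase ε n) X.unop := fun X => lift_toUnit_comp_unop_hom b
  refine ⟨Dn, nonempty_foldAdjunction 𝕋.base adj n b k (fun X i => ?_) (fun {X M} φ ψ h₁ h₂ => ?_)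
    (fun {X M} β γ h => ?_)⟩
  · rw [he, lift_whiskerRight, Category.assoc, hk₀]
  · apply Quiver.Hom.unop_inj
    ext m
    apply foldComparison_injective ε n X.unop
    refine Prod.ext ?_ (funext fun i => ?_)
    · have := congr(($h₁).unop.hom m)
      simp only [unop_comp, CommAlgCat.hom_comp] at this
      rw [hb] at this
      exact this
    · exact congr(($(h₂ i)).unop.hom m)
  · obtain ⟨φ, h₁, h₂⟩ := exists_foldAlg_lift ε n (B := X.unop) (C := M.unop) β.unop.hom
      (fun i => (γ i).unop.hom) (fun i => by
        have := congr(($(h i)).unop.hom)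
        rw [he] at this
        simp only [unop_comp, CommAlgCat.hom_comp] at this
        rw [lift_toUnit_comp_unop_hom] at this
        exact this)
    refine ⟨(CommAlgCat.ofHom φ).op, ?_, fun i => ?_⟩
    · apply Quiver.Hom.unop_inj
      apply CommAlgCat.hom_ext
      rw [unop_comp, CommAlgCat.hom_comp, hb]
      exact h₁
    · exact Quiver.Hom.unop_inj (CommAlgCat.hom_ext (h₂ i))

end Affine

/-! ### Functions as morphisms to the affine line -/

section AffineLine

variable {R : Type u} [CommRing R]

/-- The morphism to the affine line given by a function. -/
def toLine {X : Aff R} (w : X.unop) : X ⟶ op (CommAlgCat.of R (Polynomial R)) :=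
  (CommAlgCat.ofHom (Polynomial.aeval w)).op

theorem toLine_unop_hom_X {X : Aff R} (w : X.unop) :
    (toLine w).unop.hom Polynomial.X = w :=
  Polynomial.aeval_X w

theorem toLine_injective {X : Aff R} : Function.Injective (toLine (X := X)) := fun w w' h => by
  rw [← toLine_unop_hom_X w, h, toLine_unop_hom_X]

theorem toLine_eq {X : Aff R} (f : X ⟶ op (CommAlgCat.of R (Polynomial R))) :
    f = toLine (f.unop.hom (Polynomial.X : Polynomial R)) := by
  apply Quiver.Hom.unop_inj
  apply CommAlgCat.hom_ext
  exact Polynomial.algHom_ext (Polynomial.aeval_X _).symm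

theorem comp_toLine {X Y : Aff R} (f : X ⟶ Y) (w : Y.unop) :
    f ≫ toLine w = toLine (f.unop.hom w) := by
  rw [toLine_eq (f ≫ toLine w), unop_comp, CommAlgCat.hom_comp, AlgHom.comp_apply,
    toLine_unop_hom_X]

end AffineLine

/-! ### Finite projectivity of the representing algebra -/

section Coexponentiable

variable {R : Type u} [CommRing R] {D : Aff R}


/-- An injective algebra map is an epimorphism of affine schemes, and the left adjoint `D ⊗ -`
preserves it; morphisms to the affine line turn this back into injectivity. -/
theorem injective_map_of_adjunction {T : Aff R ⥤ Aff R} (adj : tensorLeft D ⊣ T)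
    {B B' : Type u} [CommRing B] [Algebra R B] [CommRing B']
    [Algebra R B'] {g : B →ₐ[R] B'} (hg : Function.Injective g) :
    Function.Injective (Algebra.TensorProduct.map (AlgHom.id R D.unop) g) := by
  intro w w' h
  let f : op (CommAlgCat.of R B') ⟶ op (CommAlgCat.of R B) := (CommAlgCat.ofHom g).op
  have h₁ : D ◁ f ≫ toLine (X := D ⊗ op (CommAlgCat.of R B)) w = D ◁ f ≫ toLine w' := by
    rw [comp_toLine, comp_toLine]
    exact congrArg toLine h
  refine toLine_injective (X := D ⊗ op (CommAlgCat.of R B)) ((transpose adj _ _).injective ?_)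
  have h₂ := congrArg (transpose adj _ _) h₁
  rw [transpose_whiskerLeft_comp, transpose_whiskerLeft_comp] at h₂
  apply Quiver.Hom.unop_inj
  ext m
  exact hg congr(($h₂).unop.hom m)

theorem flat_of_adjunction {T : Aff R ⥤ Aff R} (adj : tensorLeft D ⊣ T)
    : Module.Flat R D.unop := by
  rw [Module.Flat.iff_lTensor_injective']
  intro I
  -- An ideal is not a unital algebra, so `I → R` is replaced by `R ⋉ I → R ⋉ R` and recovered on
  -- the square-zero summands.
  have h := injective_map_of_adjunction adj
    (g := TrivSqZeroExt.map (R' := R) (I.subtype : I →ₗ[R] R)) (by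
      intro x y hxy
      have h₁ := congrArg TrivSqZeroExt.fst hxy
      have h₂ := congrArg TrivSqZeroExt.snd hxy
      simp only [TrivSqZeroExt.fst_map, TrivSqZeroExt.snd_map] at h₁ h₂
      exact TrivSqZeroExt.ext h₁ (Subtype.ext h₂))
  have h' : Function.Injective ((TrivSqZeroExt.inrHom R I).lTensor D.unop) := by
    refine Function.LeftInverse.injective
      (g := (TrivSqZeroExt.sndHom R I).lTensor D.unop) fun t => ?_
    rw [← LinearMap.comp_apply, ← LinearMap.lTensor_comp]
    have : TrivSqZeroExt.sndHom R I ∘ₗ TrivSqZeroExt.inrHom R I = LinearMap.id := by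
      ext; simp
    rw [this, LinearMap.lTensor_id, LinearMap.id_apply]
  refine Function.Injective.of_comp (f := (TrivSqZeroExt.inrHom R R).lTensor D.unop) ?_
  have hc : (TrivSqZeroExt.inrHom R R).lTensor D.unop ∘ I.subtype.lTensor D.unop =
      Algebra.TensorProduct.map (AlgHom.id R D.unop)
        (TrivSqZeroExt.map (R' := R) (I.subtype : I →ₗ[R] R)) ∘
        (TrivSqZeroExt.inrHom R I).lTensor D.unop := by
    funext t
    induction t with
    | zero => simp
    | tmul a b => simp
    | add a b ha hb =>
      simp only [Function.comp_apply, map_add] at ha hb ⊢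
      rw [ha, hb]
  rw [hc]
  exact h.comp h'

/-- `Spec (R^ι)` is the coproduct of `ι` copies of the terminal object (`R^ι` is a product of
algebras), and `D ⊗ -` preserves it; functions on the result form a power of the algebra of `D`. -/
theorem bijective_piScalarRightHom_of_adjunction {T : Aff R ⥤ Aff R} (adj : tensorLeft D ⊣ T)
    (ι : Type u) :
    Function.Bijective (TensorProduct.piScalarRightHom R R D.unop ι) := by
  let Q : Aff R := op (CommAlgCat.of R (ι → R))
  let pt (i : ι) : 𝟙_ (Aff R) ⟶ Q := (CommAlgCat.ofHom (Pi.evalAlgHom R (fun _ : ι => R) i)).op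
  have hpt : ∀ (i : ι) (w : D.unop ⊗[R] (ι → R)),
      ((D ◁ pt i).unop.hom w : D.unop ⊗[R] R) =
        TensorProduct.piScalarRightHom R R D.unop ι w i ⊗ₜ 1 := fun i w => by
    change Algebra.TensorProduct.map (AlgHom.id R D.unop) (Pi.evalAlgHom R (fun _ : ι => R) i) w = _
    induction w with
    | zero => simp
    | tmul a f => simp [TensorProduct.smul_tmul]
    | add a b ha hb => rw [map_add, ha, hb, map_add, Pi.add_apply, TensorProduct.add_tmul]
  constructor
  · intro w w' h
    refine toLine_injective (X := D ⊗ Q) ((transpose adj _ _).injective ?_)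
    apply Quiver.Hom.unop_inj
    ext m i
    have h₁ : D ◁ pt i ≫ toLine (X := D ⊗ Q) w = D ◁ pt i ≫ toLine (X := D ⊗ Q) w' := by
      rw [comp_toLine, comp_toLine]
      congr 1
      refine (hpt i w).trans (Eq.trans ?_ (hpt i w').symm)
      rw [h]
    have h₂ := congrArg (transpose adj _ _) h₁
    rw [transpose_whiskerLeft_comp, transpose_whiskerLeft_comp] at h₂
    exact congr(($h₂).unop.hom m)
  · intro a
    let φ (i : ι) : D ⊗ 𝟙_ (Aff R) ⟶ op (CommAlgCat.of R (Polynomial R)) :=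
      toLine (X := D ⊗ 𝟙_ (Aff R)) (a i ⊗ₜ[R] (1 : R))
    let ψ : Q ⟶ T.obj (op (CommAlgCat.of R (Polynomial R))) :=
      (CommAlgCat.ofHom (AlgHom.pi fun i => (transpose adj _ _ (φ i)).unop.hom)).op
    have hψ : ∀ i, pt i ≫ ψ = transpose adj _ _ (φ i) := fun i => rfl
    let w : (D ⊗ Q).unop := ((transpose adj _ _).symm ψ).unop.hom (Polynomial.X : Polynomial R)
    refine ⟨w, funext fun i => ?_⟩
    have h₁ : D ◁ pt i ≫ (transpose adj _ _).symm ψ = φ i := by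
      rw [← transpose_symm_comp, hψ, Equiv.symm_apply_apply]
    rw [toLine_eq ((transpose adj _ _).symm ψ), comp_toLine] at h₁
    have h₂ := (hpt i w).symm.trans (toLine_injective h₁)
    simpa using congrArg (TensorProduct.rid R D.unop) h₂

theorem finite_projective_of_adjunction {T : Aff R ⥤ Aff R} (adj : tensorLeft D ⊣ T)
    :
    Module.Finite R D.unop ∧ Module.Projective R D.unop := by
  have := flat_of_adjunction adj
  exact finite_projective_of_flat (bijective_piScalarRightHom_of_adjunction adj)

end Coexponentiable

/-! ### Pairings into fold pullbacks -/

section Pairings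

universe v v₁ u₁

variable {C : Type u} [Category.{v} C] {D : Type u₁} [Category.{v₁} D]

section

variable {E B : C} (q : E ⟶ B) [HasFoldPullback q 2] {X : C} (f g : X ⟶ E) (h : f ≫ q = g ≫ q)

theorem foldPair_π_zero : foldPair q f g h ≫ foldπ q 0 = f := WidePullback.lift_π _ _ _ _ _

theorem foldPair_π_one : foldPair q f g h ≫ foldπ q 1 = g := WidePullback.lift_π _ _ _ _ _

variable {q} in
theorem foldPullback_two_hom_ext {a b : X ⟶ foldPullback q 2}
    (h₀ : a ≫ foldπ q 0 = b ≫ foldπ q 0) (h₁ : a ≫ foldπ q 1 = b ≫ foldπ q 1) : a = b := by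
  refine WidePullback.hom_ext _ _ _ (fun i => ?_) ?_
  · fin_cases i
    · exact h₀
    · exact h₁
  · have := congrArg (· ≫ q) h₀
    simpa only [Category.assoc, foldπ, WidePullback.π_arrow] using this

end

variable (F : C ⥤ D) {E B : C} (q : E ⟶ B) [HasFoldPullback q 2]
  [PreservesLimit (foldCospan q 2) F] {X : D} (f g : X ⟶ F.obj E)
  (h : f ≫ F.map q = g ≫ F.map q)

theorem mapPair_π_zero : mapPair F q f g h ≫ F.map (foldπ q 0) = f :=
  (isLimitOfPreserves F (limit.isLimit (foldCospan q 2))).fac _ (some (0 : Fin 2))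

theorem mapPair_π_one : mapPair F q f g h ≫ F.map (foldπ q 1) = g :=
  (isLimitOfPreserves F (limit.isLimit (foldCospan q 2))).fac _ (some (1 : Fin 2))

variable {F q} in
theorem map_foldPullback_two_hom_ext {a b : X ⟶ F.obj (foldPullback q 2)}
    (h₀ : a ≫ F.map (foldπ q 0) = b ≫ F.map (foldπ q 0))
    (h₁ : a ≫ F.map (foldπ q 1) = b ≫ F.map (foldπ q 1)) : a = b := by
  refine (isLimitOfPreserves F (limit.isLimit (foldCospan q 2))).hom_ext fun j => ?_
  rcases j with _ | i
  · have := congrArg (· ≫ F.map q) h₀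
    simp only [Category.assoc, ← F.map_comp, foldπ, WidePullback.π_arrow] at this
    exact this
  · fin_cases i
    · exact h₀
    · exact h₁

end Pairings

/-! ### The sum and the universal lift -/

section UniversalLift

universe v

variable {C : Type u} [Category.{v} C] (𝕋 : TangentStructure C)

/-- The sum of a two-fold fibre power. -/
def TangentStructure.sum (M : C) : foldPullback (𝕋.base.proj M) 2 ⟶ 𝕋.T.obj M := 𝕋.s.app M

theorem TangentStructure.foldPair_zero_add (M : C)
    (h : (𝕋.base.proj M ≫ 𝕋.z.app M) ≫ 𝕋.base.proj M = 𝟙 (𝕋.T.obj M) ≫ 𝕋.base.proj M) :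
    foldPair (𝕋.base.proj M) (𝕋.base.proj M ≫ 𝕋.z.app M) (𝟙 _) h ≫ 𝕋.sum M = 𝟙 _ :=
  (𝕋.additive M).zero_add

theorem TangentStructure.foldPair_add_zero (M : C)
    (h : 𝟙 (𝕋.T.obj M) ≫ 𝕋.base.proj M = (𝕋.base.proj M ≫ 𝕋.z.app M) ≫ 𝕋.base.proj M) :
    foldPair (𝕋.base.proj M) (𝟙 _) (𝕋.base.proj M ≫ 𝕋.z.app M) h ≫ 𝕋.sum M = 𝟙 _ := by
  have hc : foldPair (𝕋.base.proj M) (foldπ (𝕋.base.proj M) (1 : Fin 2)) (foldπ _ 0)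
      (foldπ_comp _ _ _) ≫ 𝕋.sum M = 𝕋.sum M := (𝕋.additive M).add_comm
  refine Eq.trans ?_ (𝕋.foldPair_zero_add M h.symm)
  conv_rhs => rw [← hc]
  rw [← Category.assoc]
  refine congrArg (· ≫ 𝕋.sum M) ?_
  apply foldPullback_two_hom_ext
  · rw [Category.assoc, foldPair_π_zero, foldPair_π_zero, foldPair_π_one]
  · rw [Category.assoc, foldPair_π_one, foldPair_π_one, foldPair_π_zero]

theorem TangentStructure.zero_proj (M : C) : 𝕋.z.app M ≫ 𝕋.base.proj M = 𝟙 M :=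
  (𝕋.additive M).zero_proj

theorem TangentStructure.comp_z {M N : C} (f : M ⟶ N) :
    f ≫ 𝕋.z.app N = 𝕋.z.app M ≫ 𝕋.T.map f := 𝕋.z.naturality f

theorem TangentStructure.map_comp_proj {M N : C} (f : M ⟶ N) :
    𝕋.T.map f ≫ 𝕋.base.proj N = 𝕋.base.proj M ≫ f := 𝕋.base.p.naturality f

/-- The map induced by a morphism on two-fold fibre powers of tangent bundles. -/
def TangentStructure.map₂ {M N : C} (f : M ⟶ N) :
    foldPullback (𝕋.base.proj M) 2 ⟶ foldPullback (𝕋.base.proj N) 2 :=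
  foldMap (𝕋.T.map f) f (𝕋.map_comp_proj f) 2

theorem TangentStructure.map₂_sum {M N : C} (f : M ⟶ N) :
    𝕋.map₂ f ≫ 𝕋.sum N = 𝕋.sum M ≫ 𝕋.T.map f := 𝕋.s.naturality f

theorem TangentStructure.map₂_π {M N : C} (f : M ⟶ N) (i : Fin 2) :
    𝕋.map₂ f ≫ foldπ (𝕋.base.proj N) i = foldπ (𝕋.base.proj M) i ≫ 𝕋.T.map f :=
  foldMap_π _ _ _ _ _

theorem TangentStructure.liftPair_condition (M : C) :
    (foldπ (𝕋.base.proj M) (0 : Fin 2) ≫ 𝕋.l.app M) ≫ 𝕋.T.map (𝕋.base.proj M) =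
      (foldπ (𝕋.base.proj M) 1 ≫ 𝕋.z.app (𝕋.T.obj M)) ≫ 𝕋.T.map (𝕋.base.proj M) := by
  have h₁ : 𝕋.l.app M ≫ 𝕋.T.map (𝕋.base.proj M) = 𝕋.base.proj M ≫ 𝕋.z.app M :=
    (𝕋.lift_additive M).proj
  rw [Category.assoc, Category.assoc, ← 𝕋.comp_z, h₁, ← Category.assoc, ← Category.assoc,
    foldπ_comp _ 0 1]

/-- The morphism whose universality is the last axiom of a tangent structure. -/
def TangentStructure.universalLift (M : C) :
    foldPullback (𝕋.base.proj M) 2 ⟶ 𝕋.T.obj (𝕋.T.obj M) :=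
  mapPair 𝕋.T (𝕋.base.proj M) (foldπ (𝕋.base.proj M) (0 : Fin 2) ≫ 𝕋.l.app M)
    (foldπ (𝕋.base.proj M) 1 ≫ 𝕋.z.app (𝕋.T.obj M)) (𝕋.liftPair_condition M) ≫ 𝕋.T.map (𝕋.sum M)

theorem TangentStructure.isPullback_universalLift (M : C) :
    IsPullback (𝕋.universalLift M) (foldπ (𝕋.base.proj M) (0 : Fin 2) ≫ 𝕋.base.proj M)
      (𝕋.T.map (𝕋.base.proj M)) (𝕋.z.app M) :=
  𝕋.lift_universal M

theorem TangentStructure.map₂_universalLift {M N : C} (f : M ⟶ N) :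
    𝕋.map₂ f ≫ 𝕋.universalLift N = 𝕋.universalLift M ≫ 𝕋.T.map (𝕋.T.map f) := by
  have hl : 𝕋.T.map f ≫ 𝕋.l.app N = 𝕋.l.app M ≫ 𝕋.T.map (𝕋.T.map f) := 𝕋.l.naturality f
  rw [universalLift, universalLift, Category.assoc, ← 𝕋.T.map_comp, ← map₂_sum, 𝕋.T.map_comp,
    ← Category.assoc, ← Category.assoc]
  congr 1
  apply map_foldPullback_two_hom_ext
  · rw [Category.assoc, mapPair_π_zero, Category.assoc, ← 𝕋.T.map_comp, map₂_π, 𝕋.T.map_comp,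
      ← Category.assoc (mapPair _ _ _ _ _), mapPair_π_zero, ← Category.assoc, map₂_π,
      Category.assoc, Category.assoc, hl]
  · rw [Category.assoc, mapPair_π_one, Category.assoc, ← 𝕋.T.map_comp, map₂_π, 𝕋.T.map_comp,
      ← Category.assoc (mapPair _ _ _ _ _), mapPair_π_one, ← Category.assoc, map₂_π,
      Category.assoc, Category.assoc, 𝕋.comp_z]

/-- The lift of a zero vector is `Tz ∘ z`, which is neutral for `Ts`, so only the zero-section term
remains. -/
theorem TangentStructure.foldPair_zero_universalLift (M : C)
    (h : (𝕋.base.proj M ≫ 𝕋.z.app M) ≫ 𝕋.base.proj M = 𝟙 (𝕋.T.obj M) ≫ 𝕋.base.proj M) :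
    foldPair (𝕋.base.proj M) (𝕋.base.proj M ≫ 𝕋.z.app M) (𝟙 _) h ≫ 𝕋.universalLift M =
      𝕋.z.app (𝕋.T.obj M) := by
  have hl : 𝕋.z.app M ≫ 𝕋.l.app M = 𝕋.z.app M ≫ 𝕋.T.map (𝕋.z.app M) := (𝕋.lift_additive M).zero
  have hs : foldPair (𝕋.base.proj M) (𝕋.base.proj M ≫ 𝕋.z.app M) (𝟙 _) h ≫ 𝕋.sum M = 𝟙 _ :=
    𝕋.foldPair_zero_add M h
  have key : foldPair (𝕋.base.proj M) (𝕋.base.proj M ≫ 𝕋.z.app M) (𝟙 _) h ≫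
      mapPair 𝕋.T (𝕋.base.proj M) (foldπ (𝕋.base.proj M) (0 : Fin 2) ≫ 𝕋.l.app M)
        (foldπ (𝕋.base.proj M) 1 ≫ 𝕋.z.app (𝕋.T.obj M)) (𝕋.liftPair_condition M) =
      𝕋.z.app (𝕋.T.obj M) ≫
        𝕋.T.map (foldPair (𝕋.base.proj M) (𝕋.base.proj M ≫ 𝕋.z.app M) (𝟙 _) h) := by
    apply map_foldPullback_two_hom_ext
    · rw [Category.assoc, mapPair_π_zero, ← Category.assoc, foldPair_π_zero, Category.assoc, hl,
        Category.assoc, ← 𝕋.T.map_comp, foldPair_π_zero, 𝕋.T.map_comp, ← Category.assoc,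
        𝕋.comp_z, Category.assoc]
    · rw [Category.assoc, mapPair_π_one, ← Category.assoc, foldPair_π_one, Category.id_comp,
        Category.assoc, ← 𝕋.T.map_comp, foldPair_π_one, 𝕋.T.map_id, Category.comp_id]
  rw [universalLift, ← Category.assoc, key, Category.assoc, ← 𝕋.T.map_comp, hs, 𝕋.T.map_id,
    Category.comp_id]

end UniversalLift

/-! ### Tangent structure on global points -/

section GlobalPoints

open CartesianMonoidalCategory

universe v

variable {C : Type u} [Category.{v} C] [CartesianMonoidalCategory C] {D : C}

section

variable {T : C ⥤ C} (adj : tensorLeft D ⊣ T)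

/-- The generic global point of the tangent bundles. -/
def genericPoint : 𝟙_ C ⟶ T.obj D := transpose adj (𝟙_ C) D (fst D (𝟙_ C))

theorem genericPoint_comp_map {M : C} (φ : D ⟶ M) :
    genericPoint adj ≫ T.map φ = transpose adj (𝟙_ C) M (fst D (𝟙_ C) ≫ φ) := by
  rw [genericPoint, transpose_comp]

theorem genericPoint_comp_map_injective {M : C} {φ ψ : D ⟶ M}
    (h : genericPoint adj ≫ T.map φ = genericPoint adj ≫ T.map ψ) : φ = ψ := by
  rw [genericPoint_comp_map, genericPoint_comp_map, Equiv.apply_eq_iff_eq,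
    ← rightUnitor_hom, cancel_epi] at h
  exact h

theorem exists_genericPoint_comp_map {M : C} (t : 𝟙_ C ⟶ T.obj M) :
    ∃ φ : D ⟶ M, genericPoint adj ≫ T.map φ = t := by
  refine ⟨(ρ_ D).inv ≫ (transpose adj _ _).symm t, ?_⟩
  rw [genericPoint_comp_map, ← rightUnitor_hom, Iso.hom_inv_id_assoc, Equiv.apply_symm_apply]

theorem genericPoint_comp_proj (p : T ⟶ 𝟭 C) :
    genericPoint adj ≫ p.app D = inducedPoint adj p (𝟙_ C) ≫ fst D (𝟙_ C) :=
  transpose_comp_proj adj p _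

theorem toUnit_comp_genericPoint : toUnit D ≫ genericPoint adj = transpose adj D D (fst D D) := by
  rw [genericPoint, ← transpose_whiskerLeft_comp, whiskerLeft_fst]

/-- Naturality reduces to `z` at the terminal object, where `D ⟶ 𝟙_` is unique: zero vectors are
constant maps out of `D`. -/
theorem comp_app_eq_genericPoint (z : 𝟭 C ⟶ T) {M : C} (g : 𝟙_ C ⟶ M) :
    g ≫ z.app M = genericPoint adj ≫ T.map (toUnit D ≫ g) := by
  have h₁ : g ≫ z.app M = z.app (𝟙_ C) ≫ T.map g := z.naturality g
  obtain ⟨φ, hφ⟩ := exists_genericPoint_comp_map adj (z.app (𝟙_ C) : 𝟙_ C ⟶ T.obj (𝟙_ C))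
  have h₂ : φ = toUnit D := toUnit_unique _ _
  rw [h₁, ← hφ, T.map_comp, Category.assoc, h₂]

/-- The global point of the second tangent bundle given by a morphism from `D ⊗ D`. -/
def doublePoint {M : C} (φ : D ⊗ D ⟶ M) : 𝟙_ C ⟶ T.obj (T.obj M) :=
  genericPoint adj ≫ T.map (transpose adj D M φ)

theorem doublePoint_injective {M : C} : Function.Injective (doublePoint adj (M := M)) :=
  fun _ _ h => (transpose adj D M).injective (genericPoint_comp_map_injective adj h)

theorem exists_doublePoint {M : C} (t : 𝟙_ C ⟶ T.obj (T.obj M)) : ∃ φ, doublePoint adj φ = t := by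
  obtain ⟨φ, hφ⟩ := exists_genericPoint_comp_map adj t
  exact ⟨(transpose adj D M).symm φ, by rw [doublePoint, Equiv.apply_symm_apply, hφ]⟩

theorem doublePoint_comp {M N : C} (φ : D ⊗ D ⟶ M) (f : M ⟶ N) :
    doublePoint adj (φ ≫ f) = doublePoint adj φ ≫ T.map (T.map f) := by
  rw [doublePoint, transpose_comp, T.map_comp, ← Category.assoc, doublePoint]

theorem doublePoint_comp_map_proj (p : T ⟶ 𝟭 C) {M : C} (φ : D ⊗ D ⟶ M) :
    doublePoint adj φ ≫ T.map (p.app M) =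
      genericPoint adj ≫ T.map (inducedPoint adj p D ≫ φ) := by
  rw [doublePoint, Category.assoc]
  exact congrArg (genericPoint adj ≫ ·) ((T.map_comp _ _).symm.trans
    (congrArg T.map (transpose_comp_proj adj p φ)))

end

variable (𝕋 : TangentStructure C) (adj : tensorLeft D ⊣ 𝕋.T)
  {D₂ : C} {j₀ j₁ : D ⟶ D₂} {e : 𝟙_ C ⟶ D}

/-- Global points of `TM`, `T₂M` and `T²M` are maps to `M` from `D`, `D₂` and `D ⊗ D`. By Yoneda the
sum becomes `σ : D ⟶ D₂` and the universal lift becomes `ψ : D ⊗ D ⟶ D₂`; the unit laws and the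
pullback axiom become the stated properties. -/
theorem exists_comparisons (he : inducedPoint adj 𝕋.base.p (𝟙_ C) ≫ fst D (𝟙_ C) = e)
    (hj : e ≫ j₀ = e ≫ j₁)
    (huniq : ∀ {M : C} (φ ψ : D₂ ⟶ M), j₀ ≫ φ = j₀ ≫ ψ → j₁ ≫ φ = j₁ ≫ ψ → φ = ψ)
    (hex : ∀ {M : C} (α β : D ⟶ M), e ≫ α = e ≫ β → ∃ φ : D₂ ⟶ M, j₀ ≫ φ = α ∧ j₁ ≫ φ = β)
    (i₀ i₁ : D₂ ⟶ D) (h₀₀ : j₀ ≫ i₀ = 𝟙 D) (h₀₁ : j₁ ≫ i₀ = toUnit D ≫ e)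
    (h₁₀ : j₀ ≫ i₁ = toUnit D ≫ e) (h₁₁ : j₁ ≫ i₁ = 𝟙 D) :
    (∃ σ : D ⟶ D₂, σ ≫ i₀ = 𝟙 D ∧ σ ≫ i₁ = 𝟙 D) ∧
    ∃ ψ : D ⊗ D ⟶ D₂, ψ ≫ i₁ = fst D D ∧
      inducedPoint adj 𝕋.base.p D ≫ ψ = toUnit D ≫ e ≫ j₀ ∧
      (∀ {M : C} (φ φ' : D₂ ⟶ M), ψ ≫ φ = ψ ≫ φ' → φ = φ') ∧
      ∀ {M : C} (φ : D ⊗ D ⟶ M) (g : 𝟙_ C ⟶ M),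
        inducedPoint adj 𝕋.base.p D ≫ φ = toUnit D ≫ g → ∃ φ' : D₂ ⟶ M, ψ ≫ φ' = φ := by
  have hgp : genericPoint adj ≫ 𝕋.base.proj D = e := (genericPoint_comp_proj adj 𝕋.base.p).trans he
  have hgz : ∀ {M : C} (g : 𝟙_ C ⟶ M),
      g ≫ 𝕋.z.app M = genericPoint adj ≫ 𝕋.T.map (toUnit D ≫ g) :=
    fun g => comp_app_eq_genericPoint adj 𝕋.z g
  have hα : ∀ {M : C} (α : D ⟶ M),
      (genericPoint adj ≫ 𝕋.T.map α) ≫ 𝕋.base.proj M = e ≫ α := fun α => by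
    rw [Category.assoc, 𝕋.map_comp_proj, ← Category.assoc, hgp]
  -- `w` is the universal global point of `T₂`: every other is `w ≫ 𝕋.map₂ φ` for a unique `φ`.
  let w : 𝟙_ C ⟶ foldPullback (𝕋.base.proj D₂) 2 :=
    foldPair _ (genericPoint adj ≫ 𝕋.T.map j₀) (genericPoint adj ≫ 𝕋.T.map j₁) (by
      rw [hα, hα, hj])
  have hw₀ : ∀ {M : C} (φ : D₂ ⟶ M), (w ≫ 𝕋.map₂ φ) ≫ foldπ (𝕋.base.proj M) 0 =
      genericPoint adj ≫ 𝕋.T.map (j₀ ≫ φ) := fun φ => by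
    rw [Category.assoc, 𝕋.map₂_π, ← Category.assoc, foldPair_π_zero, Category.assoc,
      ← 𝕋.T.map_comp]
  have hw₁ : ∀ {M : C} (φ : D₂ ⟶ M), (w ≫ 𝕋.map₂ φ) ≫ foldπ (𝕋.base.proj M) 1 =
      genericPoint adj ≫ 𝕋.T.map (j₁ ≫ φ) := fun φ => by
    rw [Category.assoc, 𝕋.map₂_π, ← Category.assoc, foldPair_π_one, Category.assoc,
      ← 𝕋.T.map_comp]
  have hpz : genericPoint adj ≫ 𝕋.base.proj D ≫ 𝕋.z.app D =
      genericPoint adj ≫ 𝕋.T.map (toUnit D ≫ e) := by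
    rw [← Category.assoc, hgp, hgz]
  have hc : (𝕋.base.proj D ≫ 𝕋.z.app D) ≫ 𝕋.base.proj D = 𝟙 (𝕋.T.obj D) ≫ 𝕋.base.proj D := by
    rw [Category.assoc, 𝕋.zero_proj, Category.comp_id, Category.id_comp]
  have hwi₁ : w ≫ 𝕋.map₂ i₁ = genericPoint adj ≫ foldPair (𝕋.base.proj D) _ _ hc := by
    apply foldPullback_two_hom_ext
    · rw [hw₀, h₁₀, Category.assoc, foldPair_π_zero, hpz]
    · rw [hw₁, h₁₁, Category.assoc, foldPair_π_one, 𝕋.T.map_id]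
  have hwi₀ : w ≫ 𝕋.map₂ i₀ = genericPoint adj ≫ foldPair (𝕋.base.proj D) _ _ hc.symm := by
    apply foldPullback_two_hom_ext
    · rw [hw₀, h₀₀, Category.assoc, foldPair_π_zero, 𝕋.T.map_id]
    · rw [hw₁, h₀₁, Category.assoc, foldPair_π_one, hpz]
  have hwinj : ∀ {M : C} (φ φ' : D₂ ⟶ M), w ≫ 𝕋.map₂ φ = w ≫ 𝕋.map₂ φ' → φ = φ' :=
    fun φ φ' h => huniq _ _
      (genericPoint_comp_map_injective adj (by rw [← hw₀, h, hw₀]))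
      (genericPoint_comp_map_injective adj (by rw [← hw₁, h, hw₁]))
  refine ⟨?_, ?_⟩
  · obtain ⟨σ, hσ⟩ := exists_genericPoint_comp_map adj (w ≫ 𝕋.sum D₂)
    refine ⟨σ, genericPoint_comp_map_injective adj ?_, genericPoint_comp_map_injective adj ?_⟩
    · rw [𝕋.T.map_comp, ← Category.assoc, hσ, Category.assoc, ← 𝕋.map₂_sum, ← Category.assoc, hwi₀,
        Category.assoc, 𝕋.foldPair_add_zero, 𝕋.T.map_id]
    · rw [𝕋.T.map_comp, ← Category.assoc, hσ, Category.assoc, ← 𝕋.map₂_sum, ← Category.assoc, hwi₁,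
        Category.assoc, 𝕋.foldPair_zero_add, 𝕋.T.map_id]
  · obtain ⟨ψ, hψ⟩ := exists_doublePoint adj (w ≫ 𝕋.universalLift D₂)
    have hψ' : ∀ {M : C} (φ : D₂ ⟶ M),
        doublePoint adj (ψ ≫ φ) = (w ≫ 𝕋.map₂ φ) ≫ 𝕋.universalLift M := fun φ => by
      rw [doublePoint_comp, hψ, Category.assoc, Category.assoc, 𝕋.map₂_universalLift]
    refine ⟨ψ, doublePoint_injective adj ?_, genericPoint_comp_map_injective adj ?_,
      fun {M} φ φ' h => hwinj _ _ ?_, fun {M} φ g h => ?_⟩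
    · rw [hψ', hwi₁, Category.assoc, 𝕋.foldPair_zero_universalLift, hgz, toUnit_comp_genericPoint]
      rfl
    · rw [← doublePoint_comp_map_proj, hψ, Category.assoc]
      rw [show 𝕋.universalLift D₂ ≫ 𝕋.T.map (𝕋.base.p.app D₂) = _ from
        (𝕋.isPullback_universalLift D₂).w, ← Category.assoc, ← Category.assoc w, foldPair_π_zero,
        hα, hgz]
    · refine (𝕋.isPullback_universalLift M).hom_ext ?_ ?_
      · rw [← hψ', h, hψ']
      -- The leg to `M` is determined by the universal lift: apply `Tp`, then cancel `z` with `p`.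
      · have h' : (w ≫ 𝕋.map₂ φ) ≫ 𝕋.universalLift M = (w ≫ 𝕋.map₂ φ') ≫ 𝕋.universalLift M := by
          rw [← hψ', h, hψ']
        have := congrArg (fun t => t ≫ 𝕋.T.map (𝕋.base.proj M) ≫ 𝕋.base.proj _) h'
        simp only [Category.assoc, reassoc_of% (𝕋.isPullback_universalLift M).w, 𝕋.zero_proj,
          Category.comp_id] at this
        simpa only [Category.assoc] using this
    · have hsq : doublePoint adj φ ≫ 𝕋.T.map (𝕋.base.proj M) = g ≫ 𝕋.z.app M := by
        rw [doublePoint_comp_map_proj, h, hgz]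
      let t := (𝕋.isPullback_universalLift M).lift _ _ hsq
      obtain ⟨α, hα'⟩ := exists_genericPoint_comp_map adj (t ≫ foldπ (𝕋.base.proj M) 0)
      obtain ⟨β, hβ⟩ := exists_genericPoint_comp_map adj (t ≫ foldπ (𝕋.base.proj M) 1)
      obtain ⟨φ', h₀, h₁⟩ := hex α β (by
        rw [← hα, ← hα, hα', hβ, Category.assoc, Category.assoc, foldπ_comp _ 0 1])
      have ht : w ≫ 𝕋.map₂ φ' = t := by
        apply foldPullback_two_hom_ext
        · rw [hw₀, h₀, hα']
        · rw [hw₁, h₁, hβ]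
      refine ⟨φ', doublePoint_injective adj ?_⟩
      rw [hψ', ht]
      exact (𝕋.isPullback_universalLift M).lift_fst _ _ hsq

end GlobalPoints

/-! ### The augmentation ideal and its tensor square -/

section FoldTwo

variable {R : Type u} [CommRing R] {A : Type u} [CommRing A] [Algebra R A] (ε : A →ₐ[R] R)

/-- The inclusion of an augmented algebra as a factor of its fibre powers. -/
def foldAlgIncl {n : ℕ} (j : Fin n) : A →ₐ[R] foldAlg ε n :=
  (AlgHom.prod ε (AlgHom.pi fun i => if i = j then AlgHom.id R A else
    (Algebra.ofId R A).comp ε)).codRestrict _ fun a i => by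
      by_cases h : i = j <;> simp [h, Algebra.ofId_apply]

theorem foldAlgProj_comp_incl_self {n : ℕ} (j : Fin n) :
    (foldAlgProj ε n j).comp (foldAlgIncl ε j) = AlgHom.id R A := by
  ext a
  change (if j = j then AlgHom.id R A else (Algebra.ofId R A).comp ε) a = a
  rw [if_pos rfl, AlgHom.id_apply]

theorem foldAlgProj_comp_incl_of_ne {n : ℕ} {i j : Fin n} (h : i ≠ j) :
    (foldAlgProj ε n i).comp (foldAlgIncl ε j) = (Algebra.ofId R A).comp ε := by
  ext a
  change (if i = j then AlgHom.id R A else (Algebra.ofId R A).comp ε) a = _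
  rw [if_neg h]

theorem foldAlgBase_incl {n : ℕ} (j : Fin n) (a : A) :
    foldAlgBase ε n (foldAlgIncl ε j a) = ε a := rfl

theorem foldAlg_ext {n : ℕ} {x y : foldAlg ε n} (h : foldAlgBase ε n x = foldAlgBase ε n y)
    (h' : ∀ i, foldAlgProj ε n i x = foldAlgProj ε n i y) : x = y :=
  Subtype.ext (Prod.ext h (funext h'))

theorem foldAlgProj_incl_self {n : ℕ} (j : Fin n) (a : A) :
    foldAlgProj ε n j (foldAlgIncl ε j a) = a := congr($(foldAlgProj_comp_incl_self ε j) a)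

theorem foldAlgProj_incl_of_ne {n : ℕ} {i j : Fin n} (h : i ≠ j) (a : A) :
    foldAlgProj ε n i (foldAlgIncl ε j a) = algebraMap R A (ε a) :=
  congr($(foldAlgProj_comp_incl_of_ne ε h) a)

theorem foldAlgIncl_mul_eq_zero {x y : A} (hx : ε x = 0) (hy : ε y = 0) :
    foldAlgIncl ε (0 : Fin 2) x * foldAlgIncl ε 1 y = 0 := by
  refine foldAlg_ext ε ?_ fun i => ?_
  · rw [map_mul, foldAlgBase_incl, hx, zero_mul, map_zero]
  · rw [map_mul, map_zero]
    fin_cases i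
    · exact mul_eq_zero_of_right _
        (by rw [foldAlgProj_incl_of_ne ε (by decide), hy, map_zero])
    · exact mul_eq_zero_of_left
        (by rw [foldAlgProj_incl_of_ne ε (by decide), hx, map_zero]) _

theorem foldAlg_two_eq (d : foldAlg ε 2) :
    d = foldAlgIncl ε 0 (augProj ε (foldAlgProj ε 2 0 d) : A) +
      foldAlgIncl ε 1 (foldAlgProj ε 2 1 d) := by
  have h : ∀ i, ε (foldAlgProj ε 2 i d) = foldAlgBase ε 2 d := fun i =>
    congr($(comp_foldAlgProj ε 2 i) d)
  refine foldAlg_ext ε ?_ fun i => ?_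
  · rw [map_add, foldAlgBase_incl, foldAlgBase_incl, h]
    simp
  · rw [map_add]
    fin_cases i
    · change foldAlgProj ε 2 0 d = foldAlgProj ε 2 0 _ + foldAlgProj ε 2 0 _
      rw [foldAlgProj_incl_self, foldAlgProj_incl_of_ne ε (by decide), h, coe_augProj, h,
        sub_add_cancel]
    · change foldAlgProj ε 2 1 d = foldAlgProj ε 2 1 _ + foldAlgProj ε 2 1 _
      rw [foldAlgProj_incl_self, foldAlgProj_incl_of_ne ε (by decide)]
      simp

/-- The augmentation ideal is isomorphic to its tensor square if the two-fold fibre power of `A` is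
the algebra of those elements of `A ⊗ A` that become constant in the second factor. -/
theorem nonempty_tensor_augIdeal_equiv (ψ : foldAlg ε 2 →ₐ[R] A ⊗[R] A)
    (hinj : Function.Injective ψ) (hincl : ∀ a, ψ (foldAlgIncl ε 1 a) = a ⊗ₜ 1)
    (hbase : ∀ d, augBaseChange ε A (ψ d) = algebraMap R A (foldAlgBase ε 2 d))
    (hrange : ∀ (w : A ⊗[R] A) (r : R), augBaseChange ε A w = algebraMap R A r → ∃ d, ψ d = w) :
    Nonempty (LinearMap.ker ε.toLinearMap ⊗[R] LinearMap.ker ε.toLinearMap ≃ₗ[R]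
      LinearMap.ker ε.toLinearMap) := by
  let I := LinearMap.ker ε.toLinearMap
  let P : A ⊗[R] A →ₗ[R] I ⊗[R] I := TensorProduct.map (augProj ε) (augProj ε)
  let J : I ⊗[R] I →ₗ[R] A ⊗[R] A := TensorProduct.map I.subtype I.subtype
  -- `Λ` sends the first copy of `I` in `A₂` into `A ⊗ A` by `ψ` and keeps the `I ⊗ I` component; by
  -- `hincl` the second copy lands in `I ⊗ 1`, which `P` kills.
  let Λ : I →ₗ[R] I ⊗[R] I := P ∘ₗ ψ.toLinearMap ∘ₗ (foldAlgIncl ε 0).toLinearMap ∘ₗ I.subtype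
  have haug : augProj ε ∘ₗ I.subtype = LinearMap.id := by
    ext x
    have hx : ε (x : A) = 0 := x.2
    simp [hx]
  have hPJ : ∀ t, P (J t) = t := fun t => by
    change (TensorProduct.map _ _ ∘ₗ TensorProduct.map _ _) t = t
    rw [← TensorProduct.map_comp, haug, TensorProduct.map_id, LinearMap.id_apply]
  have hJε : ∀ t, augBaseChange ε A (J t) = 0 := fun t => by
    induction t with
    | zero => simp
    | tmul x y =>
      have hx : ε (x : A) = 0 := x.2
      simp [J, hx]
    | add a b ha hb => rw [map_add, map_add, ha, hb, add_zero]
  have haug₁ : augProj ε 1 = 0 := by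
    ext
    simp
  -- The splitting of `A ⊗ A` induced by `A = R ⊕ I`; the last term corrects the constants counted
  -- twice.
  have hdec : ∀ w : A ⊗[R] A, w = J (P w) +
      (TensorProduct.rid R A (ε.toLinearMap.lTensor A w)) ⊗ₜ 1 + 1 ⊗ₜ augBaseChange ε A w -
        1 ⊗ₜ algebraMap R A (ε (augBaseChange ε A w)) := fun w => by
    induction w with
    | zero => simp
    | tmul a b =>
      have h₁ : J (P (a ⊗ₜ b)) = (a - algebraMap R A (ε a)) ⊗ₜ (b - algebraMap R A (ε b)) := rfl
      have h₂ : TensorProduct.rid R A (ε.toLinearMap.lTensor A (a ⊗ₜ b)) = ε b • a := by simp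
      rw [h₁, h₂, augBaseChange_tmul, map_smul, TensorProduct.sub_tmul, TensorProduct.tmul_sub,
        TensorProduct.tmul_sub, Algebra.algebraMap_eq_smul_one, Algebra.algebraMap_eq_smul_one,
        Algebra.algebraMap_eq_smul_one, smul_eq_mul, mul_smul]
      simp only [TensorProduct.tmul_smul, ← TensorProduct.smul_tmul', smul_comm (ε b) (ε a)]
      abel
    | add a b ha hb =>
      conv_lhs => rw [ha, hb]
      simp only [map_add, TensorProduct.add_tmul, TensorProduct.tmul_add]
      abel
  refine ⟨(LinearEquiv.ofBijective Λ ⟨?_, fun t => ?_⟩).symm⟩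
  · refine (injective_iff_map_eq_zero Λ).mpr fun x hx => ?_
    have hx₀ : ε (x : A) = 0 := x.2
    have hP : P (ψ (foldAlgIncl ε 0 (x : A))) = 0 := hx
    have h := hdec (ψ (foldAlgIncl ε 0 (x : A)))
    rw [hP, hbase, foldAlgBase_incl, hx₀] at h
    simp only [map_zero, TensorProduct.tmul_zero, zero_add, add_zero, sub_zero] at h
    rw [← hincl] at h
    have h' := hinj h
    have h₀ := congrArg (foldAlgProj ε 2 0) h'
    have h₁ := congrArg (foldAlgBase ε 2) h'
    rw [foldAlgBase_incl, foldAlgBase_incl, hx₀] at h₁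
    rw [foldAlgProj_incl_self, foldAlgProj_incl_of_ne ε (by decide), ← h₁, map_zero] at h₀
    exact Subtype.ext h₀
  · obtain ⟨d, hd⟩ := hrange (J t) 0 (by rw [hJε, map_zero])
    refine ⟨augProj ε (foldAlgProj ε 2 0 d), ?_⟩
    change P (ψ (foldAlgIncl ε 0 (augProj ε (foldAlgProj ε 2 0 d) : A))) = t
    have h := congrArg P hd
    rw [hPJ, foldAlg_two_eq ε d, map_add, map_add, hincl] at h
    rw [← h]
    simp [P, haug₁]

end FoldTwo

/-! ### From representability to solid algebras -/

section Solid

open CartesianMonoidalCategory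

variable {R : Type u} [CommRing R]

theorem exists_solid_of_adjunction (𝕋 : TangentStructure (Aff R)) {D : Aff R}
    (adj : tensorLeft D ⊣ 𝕋.T) :
    ∃ (M : Type u) (_ : NonUnitalCommRing M) (_ : Module R M)
      (_ : IsScalarTower R M M) (_ : SMulCommClass R M M),
      Module.Finite R M ∧ Module.Projective R M ∧ IsSolid R M ∧
        Nonempty (tensorLeft (op (squareZero R M)) ⊣ 𝕋.T) := by
  let e : 𝟙_ (Aff R) ⟶ D := inducedPoint adj 𝕋.base.p (𝟙_ _) ≫ fst D (𝟙_ _)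
  let ε : D.unop →ₐ[R] R := e.unop.hom
  have he : ∀ X, inducedPoint adj 𝕋.base.p X = lift (toUnit X ≫ e) (𝟙 X) :=
    inducedPoint_eq_lift adj 𝕋.base.p (fun F H => natEnd_eq_id) 𝕋.z 𝕋.zero_proj
  have heD : (inducedPoint adj 𝕋.base.p D).unop.hom = augBaseChange ε D.unop := by
    rw [he]
    exact lift_toUnit_comp_unop_hom e
  let D₂ : Aff R := op (CommAlgCat.of R (foldAlg ε 2))
  let j (i : Fin 2) : D ⟶ D₂ := (CommAlgCat.ofHom (foldAlgProj ε 2 i)).op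
  let ι (i : Fin 2) : D₂ ⟶ D := (CommAlgCat.ofHom (foldAlgIncl ε i)).op
  have hj : ∀ i, e ≫ j i = (CommAlgCat.ofHom (foldAlgBase ε 2)).op := fun i =>
    Quiver.Hom.unop_inj (CommAlgCat.hom_ext (comp_foldAlgProj ε 2 i))
  have hself : ∀ i, j i ≫ ι i = 𝟙 D := fun i =>
    Quiver.Hom.unop_inj (CommAlgCat.hom_ext (foldAlgProj_comp_incl_self ε i))
  have hne : ∀ {i k}, i ≠ k → j i ≫ ι k = toUnit D ≫ e := fun h =>
    Quiver.Hom.unop_inj (CommAlgCat.hom_ext (foldAlgProj_comp_incl_of_ne ε h))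
  obtain ⟨⟨σ, hσ₀, hσ₁⟩, ψ, hψ₁, hψe, hψinj, hψex⟩ := exists_comparisons 𝕋 adj (e := e)
    (j₀ := j 0) (j₁ := j 1) rfl ((hj 0).trans (hj 1).symm)
    (fun {M} φ ψ h₀ h₁ => by
      refine Quiver.Hom.unop_inj (CommAlgCat.hom_ext (AlgHom.ext fun m => ?_))
      have h : ∀ i, foldAlgProj ε 2 i (φ.unop.hom m) = foldAlgProj ε 2 i (ψ.unop.hom m) := by
        intro i
        fin_cases i
        · exact congr(($h₀).unop.hom m)
        · exact congr(($h₁).unop.hom m)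
      refine foldAlg_ext ε ?_ h
      rw [← comp_foldAlgProj ε 2 0]
      exact congrArg ε (h 0))
    (fun {M} α β h => by
      let f : M.unop →ₐ[R] foldAlg ε 2 :=
        (AlgHom.prod (ε.comp α.unop.hom) (AlgHom.pi ![α.unop.hom, β.unop.hom])).codRestrict _
          (fun m i => by
            fin_cases i
            · rfl
            · exact congr(($h).unop.hom m).symm)
      exact ⟨(CommAlgCat.ofHom f).op, rfl, rfl⟩)
    (ι 0) (ι 1) (hself 0) (hne (by decide)) (hne (by decide)) (hself 1)
  have hσ₀' : ∀ a, σ.unop.hom (foldAlgIncl ε 0 a) = a := fun a => congr(($hσ₀).unop.hom a)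
  have hσ₁' : ∀ a, σ.unop.hom (foldAlgIncl ε 1 a) = a := fun a => congr(($hσ₁).unop.hom a)
  -- `σ` restricts to the identity on both copies of `A` and is multiplicative, while products
  -- across the two copies of `I` vanish in `A₂`.
  have hsq : ∀ x y : D.unop, ε x = 0 → ε y = 0 → x * y = 0 := fun x y hx hy => by
    rw [← hσ₀' x, ← hσ₁' y]
    refine (map_mul _ _ _).symm.trans ?_
    rw [foldAlgIncl_mul_eq_zero ε hx hy]
    exact map_zero _
  obtain ⟨μ⟩ := nonempty_tensor_augIdeal_equiv ε ψ.unop.hom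
    (fun d d' h => toLine_injective (X := D₂) (hψinj _ _ (by
      rw [comp_toLine, comp_toLine]
      exact congrArg toLine h)))
    (fun a => congr(($hψ₁).unop.hom a))
    (fun d => by
      have h := congr(($hψe).unop.hom d)
      rw [hj] at h
      rw [← heD]
      exact h)
    (fun w r h => by
      obtain ⟨φ', hφ'⟩ := hψex (toLine (X := D ⊗ D) w) (toLine (X := 𝟙_ (Aff R)) r) (by
        rw [comp_toLine, comp_toLine, heD]
        exact congrArg toLine h)
      rw [toLine_eq φ', comp_toLine] at hφ'
      exact ⟨_, toLine_injective hφ'⟩)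
  obtain ⟨hfin, hproj⟩ := finite_projective_of_adjunction adj
  have haug : augProj ε ∘ₗ (LinearMap.ker ε.toLinearMap).subtype = LinearMap.id := by
    ext x
    have hx : ε (x : D.unop) = 0 := x.2
    simp [hx]
  have : Module.Finite R (LinearMap.ker ε.toLinearMap) :=
    Module.Finite.of_surjective (augProj ε) fun x => ⟨x, LinearMap.congr_fun haug x⟩
  have : Module.Projective R (LinearMap.ker ε.toLinearMap) :=
    Module.Projective.of_split _ _ haug
  refine exists_solid μ (Q := fun B => Nonempty (tensorLeft (op B) ⊣ 𝕋.T)) ?_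
  let i : op (squareZero R (LinearMap.ker ε.toLinearMap)) ≅ D := (isoSquareZero ε hsq).op
  exact ⟨adj.ofNatIsoLeft ((curriedTensor (Aff R)).mapIso i).symm⟩

theorem exists_adjunction_of_isRepresentable (𝕋 : TangentStructure (Aff R))
    (h : 𝕋.IsRepresentable) : ∃ D : Aff R, Nonempty (tensorLeft D ⊣ 𝕋.T) := by
  obtain ⟨D, ⟨adj⟩⟩ := h 1 one_pos
  refine ⟨D, ⟨adj.ofNatIsoRight (NatIso.ofComponents (fun M =>
    { hom := foldπ (𝕋.base.proj M) (0 : Fin 1)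
      inv := WidePullback.lift (𝕋.base.proj M) (fun _ => 𝟙 _) (fun _ => Category.id_comp _)
      hom_inv_id := ?_
      inv_hom_id := WidePullback.lift_π _ _ _ _ _ }) fun {M N} f => ?_)⟩⟩
  · refine WidePullback.hom_ext (fun _ : Fin 1 => 𝕋.base.proj M) _ _ (fun i => ?_) ?_
    · refine (Category.assoc _ _ _).trans ?_
      rw [WidePullback.lift_π, Subsingleton.elim i 0]
      exact (Category.comp_id _).trans (Category.id_comp _).symm
    · refine (Category.assoc _ _ _).trans ?_
      rw [WidePullback.lift_base]
      exact (WidePullback.π_arrow (fun _ : Fin 1 => 𝕋.base.proj M) 0).trans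
        (Category.id_comp _).symm
  · exact foldMap_π _ _ (𝕋.base.p.naturality f) _ _

end Solid
end TangentCat

end

theorem mainTheorem5 (R : Type u) [CommRing R]
    (𝕋 : TangentCat.TangentStructure (TangentCat.Aff R)) :
    𝕋.IsRepresentable ↔
      ∃ (M : Type u) (_ : NonUnitalCommRing M) (_ : Module R M)
        (_ : IsScalarTower R M M) (_ : SMulCommClass R M M),
        Module.Finite R M ∧ Module.Projective R M ∧ TangentCat.IsSolid R M ∧
          Nonempty (tensorLeft (op (TangentCat.squareZero R M)) ⊣ 𝕋.T) := by
  constructor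
  · intro h
    obtain ⟨D, ⟨adj⟩⟩ := TangentCat.exists_adjunction_of_isRepresentable 𝕋 h
    exact TangentCat.exists_solid_of_adjunction 𝕋 adj
  · rintro ⟨M, _, _, _, _, -, -, -, ⟨adj⟩⟩
    exact TangentCat.isRepresentable_of_adjunction 𝕋 adj
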